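/- Let $\mathcal C$ be a braided monoidal category with tensor product $\otimes$, unit object $K$ and braiding $c$ (associativity and unit constraints are omitted, and $X$ also denotes $id_X$), in which every idempotent splits. **Definitions.** A unital magma $(A,\eta_A,\mu_A)$ is an object with a two-sided unital, not necessarily associative, product. For a comonoid $D$ and a unital magma $A$ put $f*g=\mu_A\circ(f\otimes g)\circ\delta_D$ for $f,g:D\to A$. A *weak Hopf quasigroup* $H$ is a unital magma $(H,\eta_H,\mu_H)$ and a comonoid $(H,\varepsilon_H,\delta_H)$ with * (a1) $\delta_H\circ\mu_H=(\mu_H\otimes\mu_H)\circ(H\otimes c_{H,H}\otimes H)\circ(\delta_H\otimes\delta_H)$; * (a2) $\varepsilon_H\circ\mu_H\circ(\mu_H\otimes H)=\varepsilon_H\circ\mu_H\circ(H\otimes\mu_H)=((\varepsilon_H\circ\mu_H)\otimes(\varepsilon_H\circ\mu_H))\circ(H\otimes\delta_H\otimes H)=((\varepsilon_H\circ\mu_H)\otimes(\varepsilon_H\circ\mu_H))\circ(H\otimes(c_{H,H}^{-1}\circ\delta_H)\otimes H)$; * (a3) $(\delta_H\otimes H)\circ\delta_H\circ\eta_H=(H\otimes\mu_H\otimes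 H)\circ((\delta_H\circ\eta_H)\otimes(\delta_H\circ\eta_H))=(H\otimes(\mu_H\circ c_{H,H}^{-1})\otimes H)\circ((\delta_H\circ\eta_H)\otimes(\delta_H\circ\eta_H))$; * (a4) a morphism $\lambda_H:H\to H$ (the antipode) such that, with $\Pi_H^L=id_H*\lambda_H$ and $\Pi_H^R=\lambda_H*id_H$: $\Pi_H^L=((\varepsilon_H\circ\mu_H)\otimes H)\circ(H\otimes c_{H,H})\circ((\delta_H\circ\eta_H)\otimes H)$; $\Pi_H^R=(H\otimes(\varepsilon_H\circ\mu_H))\circ(c_{H,H}\otimes H)\circ(H\otimes(\delta_H\circ\eta_H))$; $\lambda_H*\Pi_H^L=\Pi_H^R*\lambda_H=\lambda_H$; $\mu_H\circ(\lambda_H\otimes\mu_H)\circ(\delta_H\otimes H)=\mu_H\circ(\Pi_H^R\otimes H)$; $\mu_H\circ(H\otimes\mu_H)\circ(H\otimes\lambda_H\otimes H)\circ(\delta_H\otimes H)=\mu_H\circ(\Pi_H^L\otimes H)$; $\mu_H\circ(\mu_H\otimes\lambda_H)\circ(H\otimes\delta_H)=\mu_H\circ(H\otimes\Pi_H^L)$;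 $\mu_H\circ(\mu_H\otimes H)\circ(H\otimes\lambda_H\otimes H)\circ(H\otimes\delta_H)=\mu_H\circ(H\otimes\Pi_H^R)$. A *right $H$-comodule magma* is a unital magma $B$ with a right $H$-comodule structure $\rho_B:B\to B\otimes H$ such that $(\mu_B\otimes\mu_H)\circ(B\otimes c_{H,B}\otimes H)\circ(\rho_B\otimes\rho_B)=\rho_B\circ\mu_B$ and $(B\otimes\Pi_H^L)\circ\rho_B\circ\eta_B=\rho_B\circ\eta_B$. An *anchor morphism* $h:H\to B$ is a morphism of right $H$-comodules and of unital magmas with * (c1) $\mu_B\circ((\mu_B\circ(B\otimes h))\otimes(h\circ\lambda_H))\circ(B\otimes\delta_H)=\mu_B\circ(B\otimes(h\circ\Pi_H^L))$; * (c2) $\mu_B\circ((\mu_B\circ(B\otimes(h\circ\lambda_H)))\otimes h)\circ(B\otimes\delta_H)=\mu_B\circ(B\otimes(h\circ\Pi_H^R))$. Put $q_B=\mu_B\circ(B\otimes(h\circ\lambda_H))\circ\rho_B$. An object of coinvariants $B^{coH}$ is an image of $q_B$, i.e. an object with $i_B:B^{coH}\to B$, $p_B:B\to B^{coH}$, $q_B=i_B\circ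 p_B$, $p_B\circ i_B=id$. A *strong $(H,B,h)$-Hopf module* is $(M,\phi_M:M\otimes B\to M,\rho_M:M\to M\otimes H)$ such that $(M,\rho_M)$ is a right $H$-comodule and * (d2-1) $\phi_M\circ(M\otimes\eta_B)=id_M$; * (d2-2) $\phi_M\circ((\phi_M\circ(M\otimes i_B))\otimes B)=\phi_M\circ(M\otimes(\mu_B\circ(i_B\otimes B)))$; * (d2-3) $\rho_M\circ\phi_M=(\phi_M\otimes\mu_H)\circ(M\otimes c_{H,B}\otimes H)\circ(\rho_M\otimes\rho_B)$; * (d2-4) $\phi_M\circ((\phi_M\circ(M\otimes h))\otimes(h\circ\lambda_H))\circ(M\otimes\delta_H)=\phi_M\circ(M\otimes(h\circ\Pi_H^L))$; * (d2-5) $\phi_M\circ((\phi_M\circ(M\otimes(h\circ\lambda_H)))\otimes h)\circ(M\otimes\delta_H)=\phi_M\circ(M\otimes(h\circ\Pi_H^R))$. Put $q_M=\phi_M\circ(M\otimes(h\circ\lambda_H))\circ\rho_M$, and let $M^{coH}$, with $i_M$, $p_M$, $q_M=i_M\circ p_M$, $p_M\circ i_M=id$, be an image of $q_M$. Let $\phi_{M^{coH}}:M^{coH}\otimes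 B^{coH}\to M^{coH}$ be the morphism with $i_M\circ\phi_{M^{coH}}=\phi_M\circ(i_M\otimes i_B)$, and let $n:M^{coH}\otimes B\to M^{coH}\otimes_{B^{coH}}B=:T$ be the coequalizer of $\phi_{M^{coH}}\otimes B$ and $M^{coH}\otimes(\mu_B\circ(i_B\otimes B))$. Let $\phi_T$, $\rho_T$ and $\omega_M:T\to M$ be determined by $\phi_T\circ(n\otimes B)=n\circ(M^{coH}\otimes\mu_B)$, $\rho_T\circ n=(n\otimes H)\circ(M^{coH}\otimes\rho_B)$ and $\omega_M\circ n=\phi_M\circ(i_M\otimes B)$. When $\omega_M$ is an isomorphism, the $\omega$-deformed action is $\phi_M^{\omega_M}=\omega_M\circ\phi_T\circ(\omega_M^{-1}\otimes B)$. **Hypotheses.** $H$ is a weak Hopf quasigroup, $B$ a right $H$-comodule magma, $h:H\to B$ an anchor morphism; $\mathcal C$ has coequalizers and $-\otimes B$, $-\otimes H$ preserve them; and $$\mu_B\circ((\mu_B\circ(B\otimes i_B))\otimes B)=\mu_B\circ(B\otimes(\mu_B\circ(i_B\otimes B))),\qquad \mu_B\circ(i_B\otimes\mu_B)=\mu_B\circ((\mu_B\circ(i_B\otimes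 B))\otimes B).$$ **Statement.** The object $B^{coH}$ exists, and for every strong $(H,B,h)$-Hopf module $(M,\phi_M,\rho_M)$ all the data above exist with $\omega_M$ an isomorphism. Let $\mathcal{SM}^H_B(h)$ be the category of strong $(H,B,h)$-Hopf modules, whose morphisms $f:M\to N$ are the morphisms of right $H$-comodules with $\phi_N^{\omega_N}\circ(f\otimes B)=f\circ\phi_M^{\omega_M}$. The following hold for every $(M,\phi_M,\rho_M)$ and every choice of these data. 1. $(T,\phi_T,\rho_T)$ is a strong $(H,B,h)$-Hopf module, and $\omega_M$ is an isomorphism of right $H$-comodules. 2. $(M,\phi_M^{\omega_M},\rho_M)$ is a strong $(H,B,h)$-Hopf module, and $$\phi_M^{\omega_M}=\phi_M\circ(q_M\otimes(\mu_B\circ(h\otimes B)))\circ(\rho_M\otimes B).$$ 3. $q_M^{\omega_M}:=\phi_M^{\omega_M}\circ(M\otimes(h\circ\lambda_H))\circ\rho_M$ equals $q_M$. Moreover $(M,\phi_M^{\omega_M},\rho_M)$ has the same object of coinvariants as $(M,\phi_M,\rho_M)$ (same $M^{coH}$, $i_M$, $p_M$, $\phi_{M^{coH}}$), the same $T$, $n$,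 $\phi_T$, $\rho_T$, and the same associated isomorphism $\omega_M$. 4. $(\phi_M^{\omega_M})^{\omega_M}=\phi_M^{\omega_M}$. 5. There is an idempotent functor $D:\mathcal{SM}^H_B(h)\to\mathcal{SM}^H_B(h)$, $D\circ D=D$, given on objects by $D(M,\phi_M,\rho_M)=(M,\phi_M^{\omega_M},\rho_M)$ and on morphisms by the identity. 6. $\phi_T^{\omega_T}=\phi_T$, i.e. $D(M^{coH}\otimes_{B^{coH}}B,\phi_T,\rho_T)=(M^{coH}\otimes_{B^{coH}}B,\phi_T,\rho_T)$. -/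

import Mathlib

open CategoryTheory MonoidalCategory BraidedCategory Limits

universe v u

namespace DoiHopf

/-- A unital magma in a monoidal category: a unit and a product that is unital on both sides
(no associativity). -/
class UnitalMagmaObj {C : Type u} [Category.{v} C] [MonoidalCategory C] (X : C) where
  /-- The unit. -/
  one : 𝟙_ C ⟶ X
  /-- The product. -/
  mul : X ⊗ X ⟶ X
  one_mul : one ▷ X ≫ mul = (λ_ X).hom
  mul_one : X ◁ one ≫ mul = (ρ_ X).hom

section Basic

variable {C : Type u} [Category.{v} C] [MonoidalCategory C]

/-- The unit of a unital magma. -/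
abbrev eta (X : C) [UnitalMagmaObj X] : 𝟙_ C ⟶ X := UnitalMagmaObj.one

/-- The product of a unital magma. -/
abbrev mu (X : C) [UnitalMagmaObj X] : X ⊗ X ⟶ X := UnitalMagmaObj.mul

/-- The coproduct of a comonoid. -/
abbrev delta (X : C) [ComonObj X] : X ⟶ X ⊗ X := ComonObj.comul

/-- The counit of a comonoid. -/
abbrev eps (X : C) [ComonObj X] : X ⟶ 𝟙_ C := ComonObj.counit

/-- The convolution product `f * g` of morphisms from a comonoid to a unital magma. -/
def conv {D A : C} [ComonObj D] [UnitalMagmaObj A] (f g : D ⟶ A) : D ⟶ A :=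
  delta D ≫ (f ⊗ₘ g) ≫ mu A

/-- The rebracketing isomorphism `(W ⊗ (X ⊗ Y)) ⊗ Z ≅ (W ⊗ X) ⊗ (Y ⊗ Z)`. -/
def rebracket (W X Y Z : C) : (W ⊗ (X ⊗ Y)) ⊗ Z ≅ (W ⊗ X) ⊗ (Y ⊗ Z) :=
  whiskerRightIso (α_ W X Y).symm Z ≪≫ α_ (W ⊗ X) Y Z

/-- An image of an endomorphism `q`, in the sense of splitting idempotents:
`q = ι ∘ π` and `π ∘ ι = id`. -/
structure IdempotentImage {X : C} (q : X ⟶ X) where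
  /-- The image object. -/
  obj : C
  /-- The section. -/
  ι : obj ⟶ X
  /-- The retraction. -/
  π : X ⟶ obj
  ι_π : ι ≫ π = 𝟙 obj
  π_ι : π ≫ ι = q

end Basic

section Quasigroup

variable {C : Type u} [Category.{v} C] [MonoidalCategory C] [BraidedCategory C]

/-- A weak Hopf quasigroup in a braided monoidal category. -/
class WeakHopfQuasigroup (H : C) extends UnitalMagmaObj H, ComonObj H where
  /-- (a1) -/
  mul_comul : mu H ≫ delta H = (delta H ⊗ₘ delta H) ≫ tensorμ H H H H ≫ (mu H ⊗ₘ mu H)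
  /-- (a2), first equality -/
  counit_mul_mul :
    mu H ▷ H ≫ mu H ≫ eps H = (α_ H H H).hom ≫ H ◁ mu H ≫ mu H ≫ eps H
  /-- (a2), second equality -/
  counit_mul_mul_comul :
    mu H ▷ H ≫ mu H ≫ eps H =
      (H ◁ delta H) ▷ H ≫ (rebracket H H H H).hom ≫
        ((mu H ≫ eps H) ⊗ₘ (mu H ≫ eps H)) ≫ (λ_ (𝟙_ C)).hom
  /-- (a2), third equality -/
  counit_mul_mul_comul' :
    mu H ▷ H ≫ mu H ≫ eps H =
      (H ◁ (delta H ≫ (β_ H H).inv)) ▷ H ≫ (rebracket H H H H).hom ≫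
        ((mu H ≫ eps H) ⊗ₘ (mu H ≫ eps H)) ≫ (λ_ (𝟙_ C)).hom
  /-- (a3), first equality -/
  one_comul_comul :
    eta H ≫ delta H ≫ delta H ▷ H =
      (λ_ (𝟙_ C)).inv ≫ ((eta H ≫ delta H) ⊗ₘ (eta H ≫ delta H)) ≫
        (rebracket H H H H).inv ≫ (H ◁ mu H) ▷ H
  /-- (a3), second equality -/
  one_comul_comul' :
    eta H ≫ delta H ≫ delta H ▷ H =
      (λ_ (𝟙_ C)).inv ≫ ((eta H ≫ delta H) ⊗ₘ (eta H ≫ delta H)) ≫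
        (rebracket H H H H).inv ≫ (H ◁ ((β_ H H).inv ≫ mu H)) ▷ H
  /-- (a4): the antipode. -/
  antipode : H ⟶ H
  /-- (a4-1) -/
  id_conv_antipode :
    conv (𝟙 H) antipode =
      (λ_ H).inv ≫ (eta H ≫ delta H) ▷ H ≫ (α_ H H H).hom ≫ H ◁ (β_ H H).hom ≫
        (α_ H H H).inv ≫ (mu H ≫ eps H) ▷ H ≫ (λ_ H).hom
  /-- (a4-2) -/
  antipode_conv_id :
    conv antipode (𝟙 H) =
      (ρ_ H).inv ≫ H ◁ (eta H ≫ delta H) ≫ (α_ H H H).inv ≫ (β_ H H).hom ▷ H ≫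
        (α_ H H H).hom ≫ H ◁ (mu H ≫ eps H) ≫ (ρ_ H).hom
  /-- (a4-3), left part -/
  antipode_conv_target : conv antipode (conv (𝟙 H) antipode) = antipode
  /-- (a4-3), right part -/
  source_conv_antipode : conv (conv antipode (𝟙 H)) antipode = antipode
  /-- (a4-4) -/
  antipode_mul_mul :
    delta H ▷ H ≫ (α_ H H H).hom ≫ (antipode ⊗ₘ mu H) ≫ mu H =
      conv antipode (𝟙 H) ▷ H ≫ mu H
  /-- (a4-5) -/
  mul_antipode_mul :
    delta H ▷ H ≫ (α_ H H H).hom ≫ H ◁ (antipode ▷ H) ≫ H ◁ mu H ≫ mu H =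
      conv (𝟙 H) antipode ▷ H ≫ mu H
  /-- (a4-6) -/
  mul_mul_antipode :
    H ◁ delta H ≫ (α_ H H H).inv ≫ (mu H ⊗ₘ antipode) ≫ mu H =
      H ◁ conv (𝟙 H) antipode ≫ mu H
  /-- (a4-7) -/
  mul_antipode_mul' :
    H ◁ delta H ≫ (α_ H H H).inv ≫ (H ◁ antipode) ▷ H ≫ mu H ▷ H ≫ mu H =
      H ◁ conv antipode (𝟙 H) ≫ mu H

/-- The antipode of a weak Hopf quasigroup. -/
abbrev lam (H : C) [WeakHopfQuasigroup H] : H ⟶ H := WeakHopfQuasigroup.antipode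

/-- The target morphism `id * λ`. -/
def PiL (H : C) [WeakHopfQuasigroup H] : H ⟶ H := conv (𝟙 H) (lam H)

/-- The source morphism `λ * id`. -/
def PiR (H : C) [WeakHopfQuasigroup H] : H ⟶ H := conv (lam H) (𝟙 H)

/-- `ρ` makes `M` a right comodule over the comonoid `H`. -/
structure IsRightComodule {H M : C} [ComonObj H] (ρ : M ⟶ M ⊗ H) : Prop where
  counit : ρ ≫ M ◁ eps H = (ρ_ M).inv
  coassoc : ρ ≫ ρ ▷ H = ρ ≫ M ◁ delta H ≫ (α_ M H H).inv

/-- `f` is a morphism of right `H`-comodules. -/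
def IsColinear {H M N : C} (ρM : M ⟶ M ⊗ H) (ρN : N ⟶ N ⊗ H) (f : M ⟶ N) : Prop :=
  ρM ≫ f ▷ H = f ≫ ρN

/-- A right `H`-comodule magma structure on the unital magma `B`. -/
class ComoduleMagma (H B : C) [WeakHopfQuasigroup H] [UnitalMagmaObj B] where
  /-- The coaction. -/
  coact : B ⟶ B ⊗ H
  isRightComodule : IsRightComodule coact
  mul_coact : (coact ⊗ₘ coact) ≫ tensorμ B H B H ≫ (mu B ⊗ₘ mu H) = mu B ≫ coact
  /-- The weak unitality of the coaction. -/
  one_coact : eta B ≫ coact ≫ B ◁ PiL H = eta B ≫ coact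

variable {H B : C} [WeakHopfQuasigroup H] [UnitalMagmaObj B] [ComoduleMagma H B]

variable (H B) in
/-- The coaction of a right `H`-comodule magma. -/
abbrev rho : B ⟶ B ⊗ H := ComoduleMagma.coact

/-- `h : H ⟶ B` is an anchor morphism: a multiplicative total integral satisfying (c1), (c2). -/
structure IsAnchor (h : H ⟶ B) : Prop where
  colinear : IsColinear (delta H) (rho H B) h
  map_one : eta H ≫ h = eta B
  map_mul : (h ⊗ₘ h) ≫ mu B = mu H ≫ h
  /-- (c1) -/
  mul_mul_antipode :
    B ◁ delta H ≫ (α_ B H H).inv ≫ ((B ◁ h ≫ mu B) ⊗ₘ (lam H ≫ h)) ≫ mu B =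
      B ◁ (PiL H ≫ h) ≫ mu B
  /-- (c2) -/
  mul_antipode_mul :
    B ◁ delta H ≫ (α_ B H H).inv ≫ ((B ◁ (lam H ≫ h) ≫ mu B) ⊗ₘ h) ≫ mu B =
      B ◁ (PiR H ≫ h) ≫ mu B

/-- The endomorphism `q_M = φ_M ∘ (M ⊗ (h ∘ λ_H)) ∘ ρ_M`, for an action `φ` of `B` and a coaction
`ρ` of `H` on `M`. -/
def coinvEnd (h : H ⟶ B) {M : C} (φ : M ⊗ B ⟶ M) (ρ : M ⟶ M ⊗ H) : M ⟶ M :=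
  ρ ≫ M ◁ (lam H ≫ h) ≫ φ

/-- A choice of the object of coinvariants `B^{coH}` of `B`, with `i_B` and `p_B`:
an image of `q_B = μ_B ∘ (B ⊗ (h ∘ λ_H)) ∘ ρ_B`. -/
abbrev CoinvImage (h : H ⟶ B) := IdempotentImage (coinvEnd h (mu B) (rho H B))

/-- `μ_B ∘ ((μ_B ∘ (B ⊗ i_B)) ⊗ B) = μ_B ∘ (B ⊗ (μ_B ∘ (i_B ⊗ B)))`. -/
def MiddleAssoc {h : H ⟶ B} (b : CoinvImage h) : Prop :=
  (B ◁ b.ι ≫ mu B) ▷ B ≫ mu B = (α_ B b.obj B).hom ≫ B ◁ (b.ι ▷ B ≫ mu B) ≫ mu B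

/-- `μ_B ∘ (i_B ⊗ μ_B) = μ_B ∘ ((μ_B ∘ (i_B ⊗ B)) ⊗ B)`. -/
def LeftAssoc {h : H ⟶ B} (b : CoinvImage h) : Prop :=
  (α_ b.obj B B).hom ≫ (b.ι ⊗ₘ mu B) ≫ mu B = (b.ι ▷ B ≫ mu B) ▷ B ≫ mu B

/-- `(M, φ, ρ)` is a strong `(H, B, h)`-Hopf module. -/
structure IsStrongHopfModule {h : H ⟶ B} (b : CoinvImage h) {M : C}
    (φ : M ⊗ B ⟶ M) (ρ : M ⟶ M ⊗ H) : Prop where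
  /-- (d1) -/
  isRightComodule : IsRightComodule ρ
  /-- (d2-1) -/
  act_one : M ◁ eta B ≫ φ = (ρ_ M).hom
  /-- (d2-2) -/
  act_act : (M ◁ b.ι ≫ φ) ▷ B ≫ φ = (α_ M b.obj B).hom ≫ M ◁ (b.ι ▷ B ≫ mu B) ≫ φ
  /-- (d2-3) -/
  act_coact : φ ≫ ρ = (ρ ⊗ₘ rho H B) ≫ tensorμ M H B H ≫ (φ ⊗ₘ mu H)
  /-- (d2-4) -/
  act_act_antipode :
    M ◁ delta H ≫ (α_ M H H).inv ≫ ((M ◁ h ≫ φ) ⊗ₘ (lam H ≫ h)) ≫ φ =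
      M ◁ (PiL H ≫ h) ≫ φ
  /-- (d2-5) -/
  act_antipode_act :
    M ◁ delta H ≫ (α_ M H H).inv ≫ ((M ◁ (lam H ≫ h) ≫ φ) ⊗ₘ h) ≫ φ =
      M ◁ (PiR H ≫ h) ≫ φ

/-- A strong `(H, B, h)`-Hopf module `(M, φ_M, ρ_M)`. -/
structure StrongHopfModule {h : H ⟶ B} (b : CoinvImage h) where
  /-- The underlying object. -/
  X : C
  /-- The action. -/
  act : X ⊗ B ⟶ X
  /-- The coaction. -/
  coact : X ⟶ X ⊗ H
  isStrong : IsStrongHopfModule b act coact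

/-- The data attached to a strong Hopf module with underlying object `X` in order to deform its
action; the conditions which characterize these data are in `CoinvTensor.IsFor` below.
* `N = M^{coH}` with `i = i_M` and `p = p_M`, and its right `B^{coH}`-action `actN`;
* `T = M^{coH} ⊗_{B^{coH}} B` with the projection `n`, its `B`-action `actT`,
  its `H`-coaction `coactT`, and the isomorphism `ω = ω_M : T ≅ M`. -/
structure CoinvTensor {h : H ⟶ B} (b : CoinvImage h) (X : C) where
  /-- `M^{coH}` -/
  N : C
  /-- `i_M` -/
  i : N ⟶ X
  /-- `p_M` -/
  p : X ⟶ N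
  /-- `φ_{M^{coH}}` -/
  actN : N ⊗ b.obj ⟶ N
  /-- `M^{coH} ⊗_{B^{coH}} B` -/
  T : C
  /-- `n_{M^{coH}}` -/
  n : N ⊗ B ⟶ T
  /-- the action of `B` on `M^{coH} ⊗_{B^{coH}} B` -/
  actT : T ⊗ B ⟶ T
  /-- the coaction of `H` on `M^{coH} ⊗_{B^{coH}} B` -/
  coactT : T ⟶ T ⊗ H
  /-- `ω_M` -/
  ω : T ≅ X

/-- The data `d` are the ones attached to the strong Hopf module `(X, φ, ρ)`. -/
structure CoinvTensor.IsFor {h : H ⟶ B} {b : CoinvImage h} {X : C} (d : CoinvTensor b X)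
    (φ : X ⊗ B ⟶ X) (ρ : X ⟶ X ⊗ H) : Prop where
  /-- `M^{coH}` is the image of `q_M`. -/
  i_p : d.i ≫ d.p = 𝟙 d.N
  p_i : d.p ≫ d.i = coinvEnd h φ ρ
  /-- `φ_{M^{coH}}` is the factorization of `φ_M ∘ (i_M ⊗ i_B)` through `i_M`. -/
  actN_i : d.actN ≫ d.i = (d.i ⊗ₘ b.ι) ≫ φ
  /-- `M^{coH} ⊗_{B^{coH}} B` is the coequalizer of `φ_{M^{coH}} ⊗ B` and
  `M^{coH} ⊗ (μ_B ∘ (i_B ⊗ B))`. -/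
  isCoequalizer :
    ∃ w : d.actN ▷ B ≫ d.n = ((α_ d.N b.obj B).hom ≫ d.N ◁ (b.ι ▷ B ≫ mu B)) ≫ d.n,
      Nonempty (IsColimit (Cofork.ofπ d.n w))
  /-- The action on the coequalizer is induced by `μ_B`. -/
  n_actT : d.n ▷ B ≫ d.actT = (α_ d.N B B).hom ≫ d.N ◁ mu B ≫ d.n
  /-- The coaction on the coequalizer is induced by `ρ_B`. -/
  n_coactT : d.n ≫ d.coactT = d.N ◁ rho H B ≫ (α_ d.N B H).inv ≫ d.n ▷ H
  /-- `ω_M` is induced by `φ_M ∘ (i_M ⊗ B)`. -/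
  n_ω : d.n ≫ d.ω.hom = d.i ▷ B ≫ φ

/-- The deformed action `φ_M^{ω_M} = ω_M ∘ φ_T ∘ (ω_M⁻¹ ⊗ B)`, with `T = M^{coH} ⊗_{B^{coH}} B`. -/
def CoinvTensor.deformedAct {h : H ⟶ B} {b : CoinvImage h} {X : C} (d : CoinvTensor b X) :
    X ⊗ B ⟶ X :=
  d.ω.inv ▷ B ≫ d.actT ≫ d.ω.hom

/-- A choice, for every strong Hopf module `M`, of `M^{coH}`, of the coequalizer
`M^{coH} ⊗_{B^{coH}} B`, and hence of `ω_M`. -/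
structure CoinvTensorChoice {h : H ⟶ B} (b : CoinvImage h) where
  /-- The chosen data. -/
  d : ∀ M : StrongHopfModule b, CoinvTensor b M.X
  isFor : ∀ M : StrongHopfModule b, (d M).IsFor M.act M.coact

/-- The objects of the category `SM^H_B(h)`: strong `(H, B, h)`-Hopf modules. (The choice `𝒟` only
serves to write down the isomorphisms `ω_M` that enter the definition of the morphisms.) -/
structure SM {h : H ⟶ B} {b : CoinvImage h} (𝒟 : CoinvTensorChoice b) where
  /-- The underlying strong Hopf module. -/
  mod : StrongHopfModule b

section Category

variable {h : H ⟶ B} {b : CoinvImage h} {𝒟 : CoinvTensorChoice b}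

/-- The `ω`-deformed action `φ_M^{ω_M}` of an object of `SM^H_B(h)`. -/
def SM.defAct (M : SM 𝒟) : M.mod.X ⊗ B ⟶ M.mod.X := (𝒟.d M.mod).deformedAct

/-- `f` is a morphism `M ⟶ N` of `SM^H_B(h)`: it is `H`-colinear and `B`-quasilinear. -/
structure SM.IsMorphism (M N : SM 𝒟) (f : M.mod.X ⟶ N.mod.X) : Prop where
  colinear : IsColinear M.mod.coact N.mod.coact f
  quasilinear : f ▷ B ≫ N.defAct = M.defAct ≫ f

/-- The morphisms of `SM^H_B(h)`. -/
@[ext]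
structure SM.Hom (M N : SM 𝒟) where
  /-- The underlying morphism. -/
  hom : M.mod.X ⟶ N.mod.X
  isMorphism : SM.IsMorphism M N hom

/-- The category `SM^H_B(h)`. -/
instance : Category (SM 𝒟) where
  Hom M N := SM.Hom M N
  id M := ⟨𝟙 M.mod.X, ⟨by simp [IsColinear], by simp⟩⟩
  comp {M N P} f g := ⟨f.hom ≫ g.hom,
    ⟨by
      have hf := f.isMorphism.colinear
      have hg := g.isMorphism.colinear
      unfold IsColinear at *
      rw [comp_whiskerRight, reassoc_of% hf, hg, Category.assoc],
     by
      rw [comp_whiskerRight, Category.assoc, g.isMorphism.quasilinear,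
        ← Category.assoc, f.isMorphism.quasilinear, Category.assoc]⟩⟩
  id_comp f := SM.Hom.ext (Category.id_comp f.hom)
  comp_id f := SM.Hom.ext (Category.comp_id f.hom)
  assoc f g k := SM.Hom.ext (Category.assoc f.hom g.hom k.hom)

/-- The `ω`-deformation functor `D`: `(M, φ_M, ρ_M) ↦ (M, φ_M^{ω_M}, ρ_M)` on objects and the
identity on (underlying) morphisms, given that these assignments are well defined. -/
def deformationFunctor
    (hobj : ∀ M : SM 𝒟, IsStrongHopfModule b M.defAct M.mod.coact)
    (hmap : ∀ (M N : SM 𝒟) (f : M ⟶ N),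
      SM.IsMorphism (𝒟 := 𝒟) ⟨⟨M.mod.X, M.defAct, M.mod.coact, hobj M⟩⟩
        ⟨⟨N.mod.X, N.defAct, N.mod.coact, hobj N⟩⟩ f.hom) :
    SM 𝒟 ⥤ SM 𝒟 where
  obj M := ⟨⟨M.mod.X, M.defAct, M.mod.coact, hobj M⟩⟩
  map {M N} f := ⟨f.hom, hmap M N f⟩
  map_id _ := rfl
  map_comp _ _ := rfl

end Category

end Quasigroup

end DoiHopf

set_option linter.unusedSectionVars false

/-! The product of `B` is not associative, so every manipulation rests on one of two substitutes.
Products with values of `h` can be cancelled against `h ∘ λ` by (c1), (c2), (d2-4) and (d2-5);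
products with a coinvariant in the middle or on the left can be rebracketed by (d2-2), `MiddleAssoc`
and `LeftAssoc`.

Restricting an action of `B` along `h` gives a (non-associative) Hopf action of `H`, and the theory
of `q(m) = m₀ · λ(m₁)` needs only this. The cancellation laws give `q(m₀) · m₁ = m`
(`coinvProj_act`). Identities for `δ(1)` and `Πᴸ` show that `ρ(q(m))` factors through `M ⊗ Πᴸ`
(`coinvProj_coact_eq`), and that any `n` with this property satisfies `ρ(n · b) = n · b₀ ⊗ b₁`
(`coact_act_of_coinvariant`). Hence `q(n) = n · Πᴸ(1) = n`, so that `q` is idempotent and its image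
can be split off.

For a coinvariant `n` one gets `q_M(n · b) = n · q_B(b)` (`coinv_act_coinvEnd`), so `m ↦ p(m₀) ⊗
h(m₁)` is inverse to `ω`, because `q_B(b₀) h(b₁) = b`. Transporting the action of `T` gives `φ^ω(m ⊗
b) = q(m₀) · (h(m₁) b)`. This formula sees `φ` only on coinvariants, where `φ^ω = φ`; as moreover
`q^ω = q`, a second deformation changes nothing. The axioms for `T` are those of `B` tensored with
`M^{coH}`, and the axioms for `φ^ω` follow by transport along the colinear `ω`. -/

namespace DoiHopf

/-! ### Carrying a spectator object past an action -/

section Strength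

variable {C : Type u} [Category.{v} C] [MonoidalCategory C] [BraidedCategory C]

/-- `F : M ⊗ X ⟶ M'` with a passenger `P`, which is braided past `X`. -/
def passenger (P : C) {M X M' : C} (F : M ⊗ X ⟶ M') : (M ⊗ P) ⊗ X ⟶ M' ⊗ P :=
  (α_ M P X).hom ≫ M ◁ (β_ P X).hom ≫ (α_ M X P).inv ≫ F ▷ P

theorem passenger_comp (P : C) {M X M' M'' : C} (F : M ⊗ X ⟶ M') (g : M' ⟶ M'') :
    passenger P (F ≫ g) = passenger P F ≫ g ▷ P := by
  simp [passenger]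

theorem passenger_natural {P P' : C} {M X M' : C} (F : M ⊗ X ⟶ M') (g : P ⟶ P') :
    (M ◁ g) ▷ X ≫ passenger P' F = passenger P F ≫ M' ◁ g := by
  calc _ = 𝟙 _ ⊗≫ M ◁ (g ▷ X ≫ (β_ P' X).hom) ⊗≫ F ▷ P' := by
        simp only [passenger]; monoidal
    _ = 𝟙 _ ⊗≫ M ◁ (β_ P X).hom ⊗≫ ((M ⊗ X) ◁ g ≫ F ▷ P') := by
        rw [braiding_naturality_left]; monoidal
    _ = _ := by rw [whisker_exchange]; simp only [passenger]; monoidal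

theorem whiskerLeft_passenger (P : C) {M X X' M' : C} (F : M ⊗ X ⟶ M') (f : X' ⟶ X) :
    (M ⊗ P) ◁ f ≫ passenger P F = passenger P (M ◁ f ≫ F) := by
  calc _ = 𝟙 _ ⊗≫ M ◁ (P ◁ f ≫ (β_ P X).hom) ⊗≫ F ▷ P := by
        simp only [passenger]; monoidal
    _ = _ := by rw [braiding_naturality_right]; simp only [passenger]; monoidal

theorem whiskerRight_passenger (P : C) {M N X M' : C} (F : M ⊗ X ⟶ M') (f : N ⟶ M) :
    f ▷ P ▷ X ≫ passenger P F = passenger P (f ▷ X ≫ F) := by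
  calc _ = 𝟙 _ ⊗≫ (f ▷ (P ⊗ X) ≫ M ◁ (β_ P X).hom) ⊗≫ F ▷ P := by
        simp only [passenger]; monoidal
    _ = _ := by rw [← whisker_exchange]; simp only [passenger]; monoidal

/-- By the hexagon, carrying `P` past `X` and then past `Y` is carrying it past `X ⊗ Y`. An identity
between iterated actions therefore stays valid in the presence of a passenger. -/
theorem passenger_whiskerRight_passenger (P : C) {M X Y M' M'' : C} (F : M ⊗ X ⟶ M')
    (G : M' ⊗ Y ⟶ M'') :
    passenger P F ▷ Y ≫ passenger P G =
      (α_ (M ⊗ P) X Y).hom ≫ passenger P ((α_ M X Y).inv ≫ F ▷ Y ≫ G) := by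
  simp only [passenger, braiding_tensor_right_hom]
  calc _ = 𝟙 _ ⊗≫ M ◁ (β_ P X).hom ▷ Y ⊗≫ (F ▷ (P ⊗ Y) ≫ M' ◁ (β_ P Y).hom) ⊗≫ G ▷ P := by
        monoidal
    _ = _ := by rw [← whisker_exchange]; monoidal

theorem passenger_associator_inv (P : C) {M X Y M' M'' : C} (F : M ⊗ X ⟶ M')
    (G : M' ⊗ Y ⟶ M'') :
    passenger P ((α_ M X Y).inv ≫ F ▷ Y ≫ G) =
      (α_ (M ⊗ P) X Y).inv ≫ passenger P F ▷ Y ≫ passenger P G := by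
  rw [passenger_whiskerRight_passenger, Iso.inv_hom_id_assoc]

theorem passenger_passenger (P Q : C) {M X M' : C} (F : M ⊗ X ⟶ M') :
    passenger Q (passenger P F) =
      (α_ M P Q).hom ▷ X ≫ passenger (P ⊗ Q) F ≫ (α_ M' P Q).inv := by
  simp only [passenger, braiding_tensor_left_hom]
  monoidal

theorem passenger_rightUnitor (P M : C) :
    passenger P (ρ_ M).hom = (ρ_ (M ⊗ P)).hom := by
  simp [passenger]

theorem passenger_whiskerLeft (P N : C) {M X M' : C} (F : M ⊗ X ⟶ M') :
    passenger P ((α_ N M X).hom ≫ N ◁ F) =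
      (α_ N M P).hom ▷ X ≫ (α_ N (M ⊗ P) X).hom ≫ N ◁ passenger P F ≫ (α_ N M' P).inv := by
  simp only [passenger]
  monoidal

end Strength

/-! ### The coproduct of the unit and the target morphism -/

section WeakHopfQuasigroup

variable {C : Type u} [Category.{v} C] [MonoidalCategory C] [BraidedCategory C]

/-- Multiplication of the last two tensor factors. -/
def mulLast (H M : C) [UnitalMagmaObj H] : (M ⊗ H) ⊗ H ⟶ M ⊗ H :=
  (α_ M H H).hom ≫ M ◁ mu H

theorem whiskerRight_mulLast {H M N : C} [UnitalMagmaObj H] (f : M ⟶ N) :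
    f ▷ H ▷ H ≫ mulLast H N = mulLast H M ≫ f ▷ H := by
  calc _ = 𝟙 _ ⊗≫ (f ▷ (H ⊗ H) ≫ N ◁ mu H) := by simp only [mulLast]; monoidal
    _ = _ := by rw [← whisker_exchange]; simp only [mulLast]; monoidal

/-- The codiagonal formula `m₀ · b₀ ⊗ m₁ b₁` is split into an action with `m₁` as passenger followed
by one multiplication in `H`, so that the two can be manipulated separately. -/
theorem tensorHom_tensorμ_mul {H M N M' X B : C} [UnitalMagmaObj H] (f : N ⟶ M ⊗ H)
    (g : X ⟶ B ⊗ H) (φ : M ⊗ B ⟶ M') :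
    (f ⊗ₘ g) ≫ tensorμ M H B H ≫ (φ ⊗ₘ mu H) =
      f ▷ X ≫ (M ⊗ H) ◁ g ≫ (α_ (M ⊗ H) B H).inv ≫ passenger H φ ▷ H ≫ mulLast H M' := by
  simp only [tensorμ, passenger, mulLast, MonoidalCategory.tensorHom_def]
  monoidal

variable {H : C} [WeakHopfQuasigroup H]

variable (H) in
/-- The coproduct of the unit. -/
def deltaOne : 𝟙_ C ⟶ H ⊗ H := eta H ≫ delta H

variable (H) in
/-- The counit of a product. -/
def epsMul : H ⊗ H ⟶ 𝟙_ C := mu H ≫ eps H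

/-- `m ↦ m · 1₁ ⊗ 1₂`. -/
def actDeltaOne {M : C} (ψ : M ⊗ H ⟶ M) : M ⟶ M ⊗ H :=
  (ρ_ M).inv ≫ M ◁ deltaOne H ≫ (α_ M H H).inv ≫ ψ ▷ H

variable (H) in
/-- `x ↦ 1₁ x ⊗ 1₂`. -/
def deltaOneMul : H ⟶ H ⊗ H :=
  (λ_ H).inv ≫ deltaOne H ▷ H ≫ passenger H (mu H)

theorem counit_right (H : C) [ComonObj H] : delta H ≫ H ◁ eps H = (ρ_ H).inv :=
  ComonObj.comul_counit H

theorem counit_left (H : C) [ComonObj H] : delta H ≫ eps H ▷ H = (λ_ H).inv :=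
  ComonObj.counit_comul H

theorem epsMul_assoc : mu H ▷ H ≫ epsMul H = (α_ H H H).hom ≫ H ◁ mu H ≫ epsMul H :=
  WeakHopfQuasigroup.counit_mul_mul

theorem deltaOne_comul : deltaOne H ≫ delta H ▷ H ≫ (α_ H H H).hom = deltaOne H ≫ H ◁ delta H := by
  simp [deltaOne]

theorem deltaOne_comul_right :
    deltaOne H ≫ delta H ▷ H ≫ (α_ H H H).hom = deltaOne H ≫ H ◁ actDeltaOne (mu H) := by
  have := WeakHopfQuasigroup.one_comul_comul (H := H)
  rw [← Category.assoc] at this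
  change deltaOne H ≫ _ = _ at this
  rw [reassoc_of% this]
  calc _ = 𝟙 _ ⊗≫ (deltaOne H ▷ 𝟙_ C ≫ (H ⊗ H) ◁ deltaOne H) ⊗≫ H ◁ mu H ▷ H ⊗≫ 𝟙 _ := by
        simp only [deltaOne, rebracket, MonoidalCategory.tensorHom_def, Iso.trans_inv,
          whiskerRightIso_inv, Iso.symm_inv]; monoidal
    _ = _ := by simp only [actDeltaOne]; monoidal

theorem deltaOne_comul_left :
    deltaOne H ≫ delta H ▷ H ≫ (α_ H H H).hom = deltaOne H ≫ H ◁ deltaOneMul H := by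
  have := WeakHopfQuasigroup.one_comul_comul' (H := H)
  rw [← Category.assoc] at this
  change deltaOne H ≫ _ = _ at this
  rw [reassoc_of% this]
  -- Naturality of the braiding for `δ(1) : 𝟙 ⟶ H ⊗ H` lets `δ(1)` pass a strand freely; cancelling
  -- one of the two crossings trades the inverse braiding in (a3) for the braiding in `deltaOneMul`.
  have key : (ρ_ H).inv ≫ H ◁ deltaOne H ≫ (α_ H H H).inv ≫ (β_ H H).inv ▷ H =
      (λ_ H).inv ≫ deltaOne H ▷ H ≫ (α_ H H H).hom ≫ H ◁ (β_ H H).hom ≫ (α_ H H H).inv := by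
    have h1 := braiding_naturality_left (deltaOne H) H
    rw [braiding_tensor_left_hom] at h1
    have h2 : H ◁ deltaOne H = (ρ_ H).hom ≫ (λ_ H).inv ≫ deltaOne H ▷ H ≫
      (α_ H H H).hom ≫ H ◁ (β_ H H).hom ≫ (α_ H H H).inv ≫ (β_ H H).hom ▷ H ≫
        (α_ H H H).hom := by
      rw [h1]; simp
    rw [h2]; simp
  calc _ = deltaOne H ⊗≫ H ◁ ((ρ_ H).inv ≫ H ◁ deltaOne H ≫ (α_ H H H).inv ≫ (β_ H H).inv ▷ H)
        ⊗≫ H ◁ mu H ▷ H ⊗≫ 𝟙 _ := by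
        simp only [deltaOne, rebracket, MonoidalCategory.tensorHom_def, Iso.trans_inv,
          whiskerRightIso_inv, Iso.symm_inv]; monoidal
    _ = _ := by rw [key]; simp only [deltaOneMul, passenger]; monoidal

/-- `M` with the coaction `ρ` and the unital action `ψ` is a Hopf module over `H`, except that
`ψ` need not be associative. -/
structure IsHopfAction {M : C} (ψ : M ⊗ H ⟶ M) (ρ : M ⟶ M ⊗ H) : Prop where
  isRightComodule : IsRightComodule ρ
  act_one : M ◁ eta H ≫ ψ = (ρ_ M).hom
  act_coact : ψ ≫ ρ = ρ ▷ H ≫ (M ⊗ H) ◁ delta H ≫ (α_ (M ⊗ H) H H).inv ≫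
    passenger H ψ ▷ H ≫ mulLast H M

variable (H) in
theorem isHopfAction_self : IsHopfAction (mu H) (delta H) where
  isRightComodule := ⟨counit_right H, by simp⟩
  act_one := UnitalMagmaObj.mul_one
  act_coact := by rw [WeakHopfQuasigroup.mul_comul, tensorHom_tensorμ_mul]

theorem PiL_eq : PiL H = deltaOneMul H ≫ eps H ▷ H ≫ (λ_ H).hom := by
  rw [PiL, lam, WeakHopfQuasigroup.id_conv_antipode, deltaOneMul, deltaOne, passenger]
  simp

theorem eta_PiL : eta H ≫ PiL H = eta H := by
  have h1 : eta H ≫ deltaOneMul H = deltaOne H := by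
    rw [deltaOneMul]
    calc _ = 𝟙 _ ⊗≫ (𝟙_ C ◁ eta H ≫ deltaOne H ▷ H) ⊗≫ passenger H (mu H) := by
          monoidal
      _ = 𝟙 _ ⊗≫ deltaOne H ⊗≫ ((H ⊗ H) ◁ eta H ≫ passenger H (mu H)) := by
          rw [whisker_exchange]; monoidal
      _ = _ := by
          rw [whiskerLeft_passenger, UnitalMagmaObj.mul_one, passenger_rightUnitor]; monoidal
  rw [PiL_eq, reassoc_of% h1, deltaOne, Category.assoc, reassoc_of% (counit_left H)]
  simp

/-- `ε(1₁ x z) 1₂ = Πᴸ(x z)`. -/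
theorem deltaOneMul_mul_counit :
    deltaOneMul H ▷ H ≫ passenger H (mu H) ≫ eps H ▷ H ≫ (λ_ H).hom = mu H ≫ PiL H := by
  have h1 : passenger H (mu H) ▷ H ≫ passenger H (epsMul H) =
      (α_ _ _ _).hom ≫ (H ⊗ H) ◁ mu H ≫ passenger H (epsMul H) := by
    rw [passenger_whiskerRight_passenger, whiskerLeft_passenger, epsMul_assoc,
      Iso.inv_hom_id_assoc]
  rw [PiL_eq, deltaOneMul]
  calc _ = 𝟙 _ ⊗≫ deltaOne H ▷ (H ⊗ H) ⊗≫ (passenger H (mu H) ▷ H ≫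
      (passenger H (mu H) ≫ eps H ▷ H)) ⊗≫ 𝟙 _ := by monoidal
    _ = 𝟙 _ ⊗≫ (deltaOne H ▷ (H ⊗ H) ≫ (H ⊗ H) ◁ mu H) ⊗≫ passenger H (epsMul H) ⊗≫ 𝟙 _ := by
      rw [← passenger_comp, ← epsMul, h1]; monoidal
    _ = 𝟙 _ ⊗≫ mu H ⊗≫ deltaOne H ▷ H ⊗≫ (passenger H (mu H) ≫ eps H ▷ H) ⊗≫ 𝟙 _ := by
      rw [← whisker_exchange, ← passenger_comp, ← epsMul]; monoidal
    _ = _ := by monoidal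

/-- Two morphisms that agree on the second factor of `δ(1)` agree on the image of `Πᴸ`. -/
theorem PiL_ext {Z Y : C} {f g : H ⊗ Z ⟶ Y}
    (w : deltaOne H ▷ Z ≫ (α_ H H Z).hom ≫ H ◁ f = deltaOne H ▷ Z ≫ (α_ H H Z).hom ≫ H ◁ g) :
    PiL H ▷ Z ≫ f = PiL H ▷ Z ≫ g := by
  -- Since `Πᴸ(x) = ε(1₁ x) 1₂`, the value of `f` at `Πᴸ(x) ⊗ z` comes from applying `f` to `1₂ ⊗ z`
  -- and pairing `1₁` with `x`. The inverse braiding first moves `x` past `z`, so that `1₂` and `z`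
  -- are adjacent.
  have h1 : ∀ f : H ⊗ Z ⟶ Y, PiL H ▷ Z ≫ f = (β_ Z H).inv ⊗≫
      (deltaOne H ▷ Z ≫ (α_ H H Z).hom ≫ H ◁ f) ▷ H ⊗≫ passenger Y (epsMul H) ⊗≫ 𝟙 _ :=
    fun f => by
    calc _ = (β_ Z H).inv ⊗≫ (β_ Z H).hom ⊗≫ (PiL H ▷ Z ≫ f) := by
          simp [monoidalComp]
      _ = (β_ Z H).inv ⊗≫ (𝟙_ C ◁ (β_ Z H).hom ≫ deltaOne H ▷ (H ⊗ Z)) ⊗≫ H ◁ (β_ H H).hom ▷ Z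
            ⊗≫ epsMul H ▷ (H ⊗ Z) ⊗≫ f := by
          rw [PiL_eq, deltaOneMul]; simp only [passenger, epsMul]; monoidal
      _ = (β_ Z H).inv ⊗≫ deltaOne H ▷ (Z ⊗ H) ⊗≫ H ◁ (H ◁ (β_ Z H).hom ⊗≫ (β_ H H).hom ▷ Z)
            ⊗≫ (epsMul H ▷ (H ⊗ Z) ≫ 𝟙_ C ◁ f) ⊗≫ 𝟙 _ := by
          rw [whisker_exchange]; monoidal
      _ = (β_ Z H).inv ⊗≫ deltaOne H ▷ (Z ⊗ H) ⊗≫ H ◁ ((β_ (H ⊗ Z) H).hom ≫ H ◁ f)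
            ⊗≫ epsMul H ▷ Y ⊗≫ 𝟙 _ := by
          rw [← whisker_exchange, braiding_tensor_left_hom]; monoidal
      _ = _ := by rw [← braiding_naturality_left]; simp only [passenger]; monoidal
  rw [h1, h1, w]

/-- `Πᴸ(x)₁ ⊗ Πᴸ(x)₂ = 1₁ Πᴸ(x) ⊗ 1₂`. -/
theorem PiL_comul : PiL H ≫ delta H = PiL H ≫ deltaOneMul H := by
  have h : PiL H ▷ 𝟙_ C ≫ (ρ_ H).hom ≫ delta H = PiL H ▷ 𝟙_ C ≫ (ρ_ H).hom ≫ deltaOneMul H := by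
    apply PiL_ext
    have h1 : ∀ f : H ⟶ H ⊗ H, deltaOne H ▷ 𝟙_ C ≫ (α_ H H (𝟙_ C)).hom ≫ H ◁ ((ρ_ H).hom ≫ f) =
        (ρ_ (𝟙_ C)).hom ≫ deltaOne H ≫ H ◁ f := fun f => by monoidal
    rw [h1, h1, ← deltaOne_comul, deltaOne_comul_left]
  simpa using h

end WeakHopfQuasigroup

/-! ### Hopf actions and the calculus of the target morphism -/

section HopfAction

variable {C : Type u} [Category.{v} C] [MonoidalCategory C] [BraidedCategory C]
variable {H : C} [WeakHopfQuasigroup H]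

theorem mulLast_counit (M : C) :
    mulLast H M ≫ M ◁ eps H = (α_ M H H).hom ≫ M ◁ epsMul H := by
  simp [mulLast, epsMul]

namespace IsHopfAction

variable {M : C} {ψ : M ⊗ H ⟶ M} {ρ : M ⟶ M ⊗ H}

/-- `m₀ · 1₁ ⊗ m₁ 1₂ = ρ(m)`. -/
theorem coact_act_deltaOne (hψ : IsHopfAction ψ ρ) :
    (ρ_ M).inv ≫ ρ ▷ 𝟙_ C ≫ (M ⊗ H) ◁ deltaOne H ≫ (α_ (M ⊗ H) H H).inv ≫
      passenger H ψ ▷ H ≫ mulLast H M = ρ := by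
  calc _ = 𝟙 _ ⊗≫ (ρ ▷ 𝟙_ C ≫ (M ⊗ H) ◁ eta H) ⊗≫ (M ⊗ H) ◁ delta H ⊗≫
        passenger H ψ ▷ H ≫ mulLast H M := by simp only [deltaOne]; monoidal
    _ = 𝟙 _ ⊗≫ M ◁ eta H ⊗≫ (ρ ▷ H ≫ (M ⊗ H) ◁ delta H ≫ (α_ (M ⊗ H) H H).inv ≫
        passenger H ψ ▷ H ≫ mulLast H M) := by rw [← whisker_exchange]; monoidal
    _ = 𝟙 _ ⊗≫ (M ◁ eta H ≫ ψ) ⊗≫ ρ := by rw [← hψ.act_coact]; monoidal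
    _ = ρ := by rw [hψ.act_one]; monoidal

/-- `m · x = m₀ · x₁ ε(m₁ x₂)`. -/
theorem act_eq (hψ : IsHopfAction ψ ρ) :
    ψ = ρ ▷ H ≫ (M ⊗ H) ◁ delta H ≫ (α_ (M ⊗ H) H H).inv ≫
      passenger H ψ ▷ H ≫ (α_ M H H).hom ≫ M ◁ epsMul H ≫ (ρ_ M).hom := by
  calc ψ = (ψ ≫ ρ) ≫ M ◁ eps H ≫ (ρ_ M).hom := by
        rw [Category.assoc, reassoc_of% hψ.isRightComodule.counit]; simp
    _ = _ := by
        rw [hψ.act_coact]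
        simp only [Category.assoc]
        rw [reassoc_of% (mulLast_counit M)]

/-- Expanding `m · x = m₀ · x₁ ε(m₁ x₂)` in the presence of a passenger moves the effect of the
action onto the passenger. It is used with `δ(1)` for `u` and `w`, and again with `ρ` for both. -/
theorem passenger_act_eq (hψ : IsHopfAction ψ ρ) {N : C} (u w : N ⟶ M ⊗ H) (f : H ⟶ H ⊗ H)
    (huw : u ≫ ρ ▷ H = w ≫ M ◁ f ≫ (α_ M H H).inv) :
    u ▷ H ≫ passenger H ψ = w ▷ H ≫ (M ⊗ H) ◁ delta H ≫ (α_ (M ⊗ H) H H).inv ≫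
      passenger H ψ ▷ H ≫ (α_ M H H).hom ≫
        M ◁ (f ▷ H ≫ passenger H (epsMul H) ≫ (λ_ H).hom) := by
  calc _ = u ▷ H ≫ passenger H (ρ ▷ H ≫ (M ⊗ H) ◁ delta H ≫ (α_ (M ⊗ H) H H).inv ≫
      passenger H ψ ▷ H ≫ ((α_ M H H).hom ≫ M ◁ epsMul H) ≫ (ρ_ M).hom) := by
        conv_lhs => rw [hψ.act_eq]
        simp only [Category.assoc]
    _ = (u ≫ ρ ▷ H) ▷ H ≫ ((M ⊗ H) ⊗ H) ◁ delta H ≫ (α_ ((M ⊗ H) ⊗ H) H H).inv ≫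
        passenger H (passenger H ψ) ▷ H ≫ passenger H ((α_ M H H).hom ≫ M ◁ epsMul H) ≫
          (ρ_ M).hom ▷ H := by
        rw [← whiskerRight_passenger, ← whiskerLeft_passenger, passenger_associator_inv,
          passenger_comp]
        simp
    _ = w ▷ H ⊗≫ ((M ◁ f) ▷ H ≫ (M ⊗ H ⊗ H) ◁ delta H) ⊗≫ passenger (H ⊗ H) ψ ▷ H ⊗≫
        M ◁ passenger H (epsMul H) ⊗≫ 𝟙 _ := by
        rw [huw, passenger_passenger, passenger_whiskerLeft]
        monoidal
    _ = w ▷ H ⊗≫ (M ⊗ H) ◁ delta H ⊗≫ ((M ◁ f) ▷ H ≫ passenger (H ⊗ H) ψ) ▷ H ⊗≫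
        M ◁ passenger H (epsMul H) ⊗≫ 𝟙 _ := by
        rw [← whisker_exchange]
        monoidal
    _ = _ := by
        rw [passenger_natural]
        monoidal

end IsHopfAction

/-- `1₁ x₁ ⊗ 1₂ x₂ = x₁ ⊗ x₂`. -/
theorem deltaOne_mul_comul :
    (λ_ H).inv ≫ deltaOne H ▷ H ≫ (H ⊗ H) ◁ delta H ≫ (α_ (H ⊗ H) H H).inv ≫
      passenger H (mu H) ▷ H ≫ mulLast H H = delta H := by
  calc _ = (λ_ H).inv ≫ eta H ▷ H ≫ mu H ≫ delta H := by
        rw [(isHopfAction_self H).act_coact, deltaOne]; simp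
    _ = _ := by rw [← Category.assoc (eta H ▷ H), UnitalMagmaObj.one_mul]; simp

/-- `1₁ x ⊗ 1₂ = x₁ ⊗ Πᴸ(x₂)`. -/
theorem deltaOneMul_eq : deltaOneMul H = delta H ≫ H ◁ PiL H := by
  -- Here `δ(1₁) ⊗ 1₂ = 1₁ ⊗ 1'₁ 1₂ ⊗ 1'₂`, so `1₁ x ⊗ 1₂ = 1₁ x₁ ⊗ Πᴸ(1₂ x₂)`, and `δ(1) δ(x) =
  -- δ(x)` removes the unit.
  have h := (isHopfAction_self H).passenger_act_eq (deltaOne H) (deltaOne H) (deltaOneMul H)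
    (by rw [← Category.assoc, ← deltaOne_comul_left]; simp)
  have h1 : deltaOneMul H ▷ H ≫ passenger H (epsMul H) ≫ (λ_ H).hom = mu H ≫ PiL H := by
    rw [← deltaOneMul_mul_counit, epsMul, passenger_comp, Category.assoc]
  calc _ = (λ_ H).inv ≫ deltaOne H ▷ H ≫ (H ⊗ H) ◁ delta H ≫ (α_ (H ⊗ H) H H).inv ≫
      passenger H (mu H) ▷ H ≫ (α_ H H H).hom ≫ H ◁ (mu H ≫ PiL H) := by
        rw [deltaOneMul, h, h1]
    _ = ((λ_ H).inv ≫ deltaOne H ▷ H ≫ (H ⊗ H) ◁ delta H ≫ (α_ (H ⊗ H) H H).inv ≫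
      passenger H (mu H) ▷ H ≫ mulLast H H) ≫ H ◁ PiL H := by simp [mulLast]
    _ = _ := by rw [deltaOne_mul_comul]

theorem mul_eq :
    mu H = delta H ▷ H ≫ (H ⊗ H) ◁ delta H ≫ (α_ (H ⊗ H) H H).inv ≫
      passenger H (epsMul H) ▷ H ≫ mulLast H (𝟙_ C) ≫ (λ_ H).hom := by
  calc _ = (mu H ≫ delta H) ≫ eps H ▷ H ≫ (λ_ H).hom := by
        rw [Category.assoc, reassoc_of% (counit_left H)]; simp
    _ = _ := by
        rw [(isHopfAction_self H).act_coact, epsMul, passenger_comp, comp_whiskerRight]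
        simp only [Category.assoc]
        rw [reassoc_of% (whiskerRight_mulLast (H := H) (eps H))]

/-- Naturality of the braiding for the scalar-valued `ε ∘ μ`, with one crossing cancelled. -/
theorem braiding_inv_epsMul :
    (β_ H H).inv ▷ H ≫ (α_ H H H).hom ≫ H ◁ epsMul H =
      (α_ H H H).hom ≫ H ◁ (β_ H H).hom ≫ (α_ H H H).inv ≫ epsMul H ▷ H ≫
        (λ_ H).hom ≫ (ρ_ H).inv := by
  have h := braiding_naturality_right H (epsMul H)
  rw [braiding_tensor_right_hom, braiding_tensorUnit_right] at h
  rw [← cancel_mono ((ρ_ H).hom ≫ (λ_ H).inv), ← cancel_epi ((β_ H H).hom ▷ H)]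
  simp only [Category.assoc, hom_inv_whiskerRight_assoc, h]
  simp

/-- `1₂ ε(1₁ x) ⊗ 1₃ = Πᴸ(x)₁ ⊗ Πᴸ(x)₂`. -/
theorem deltaOne_epsMul_comul :
    (λ_ H).inv ≫ deltaOne H ▷ H ≫ (α_ H H H).hom ≫ H ◁ (β_ H H).hom ≫ (α_ H H H).inv ≫
      ((delta H ≫ (β_ H H).inv) ▷ H ≫ (α_ H H H).hom ≫ H ◁ epsMul H ≫ (ρ_ H).hom) ▷ H =
    PiL H ≫ delta H := by
  calc _ = 𝟙 _ ⊗≫ deltaOne H ▷ H ⊗≫ (H ◁ (β_ H H).hom ≫ delta H ▷ (H ⊗ H)) ⊗≫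
        ((β_ H H).inv ▷ H ≫ (α_ H H H).hom ≫ H ◁ epsMul H) ▷ H ⊗≫ 𝟙 _ := by monoidal
    _ = 𝟙 _ ⊗≫ (deltaOne H ≫ delta H ▷ H ≫ (α_ H H H).hom) ▷ H ⊗≫ (H ⊗ H) ◁ (β_ H H).hom ⊗≫
        H ◁ (β_ H H).hom ▷ H ⊗≫ epsMul H ▷ (H ⊗ H) ⊗≫ 𝟙 _ := by
      rw [whisker_exchange, braiding_inv_epsMul]; monoidal
    _ = 𝟙 _ ⊗≫ deltaOne H ▷ H ⊗≫ H ◁ (delta H ▷ H ≫ (β_ (H ⊗ H) H).hom) ⊗≫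
        epsMul H ▷ (H ⊗ H) ⊗≫ 𝟙 _ := by
      rw [deltaOne_comul, braiding_tensor_left_hom]; monoidal
    _ = 𝟙 _ ⊗≫ deltaOne H ▷ H ⊗≫ H ◁ (β_ H H).hom ⊗≫ ((H ⊗ H) ◁ delta H ≫
        epsMul H ▷ (H ⊗ H)) ⊗≫ 𝟙 _ := by
      rw [braiding_naturality_left]; monoidal
    _ = _ := by
      rw [whisker_exchange, PiL_eq, deltaOneMul]
      simp only [passenger, epsMul]
      monoidal

theorem epsMul_mul_eq :
    mu H ▷ H ≫ epsMul H = 𝟙 _ ⊗≫ H ◁ (delta H ≫ (β_ H H).inv) ▷ H ⊗≫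
      H ◁ H ◁ epsMul H ⊗≫ epsMul H := by
  calc _ = (H ◁ (delta H ≫ (β_ H H).inv)) ▷ H ≫ (rebracket H H H H).hom ≫
        (epsMul H ⊗ₘ epsMul H) ≫ (λ_ (𝟙_ C)).hom := WeakHopfQuasigroup.counit_mul_mul_comul'
    _ = 𝟙 _ ⊗≫ H ◁ (delta H ≫ (β_ H H).inv) ▷ H ⊗≫
        (epsMul H ▷ (H ⊗ H) ≫ 𝟙_ C ◁ epsMul H) ⊗≫ 𝟙 _ := by
      simp only [rebracket, MonoidalCategory.tensorHom_def, Iso.trans_hom, whiskerRightIso_hom,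
        Iso.symm_hom]
      monoidal
    _ = _ := by rw [← whisker_exchange]; monoidal

/-- `ε(x₁ y) x₂ = x Πᴸ(y)`. -/
theorem comul_epsMul :
    delta H ▷ H ≫ passenger H (epsMul H) ≫ (λ_ H).hom = H ◁ PiL H ≫ mu H := by
  -- Write `x₁ ⊗ x₂` as `x₁ 1₁ ⊗ x₂ 1₂` and split `ε((x₁ 1₁) y)` by the last form of (a2). The legs
  -- of the unit then assemble to `δ(Πᴸ(y))`, leaving `ε(x₁ Πᴸ(y)₁) x₂ Πᴸ(y)₂`, which `mul_eq`
  -- identifies with `x Πᴸ(y)`.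
  calc _ = ((ρ_ H).inv ≫ delta H ▷ 𝟙_ C ≫ (H ⊗ H) ◁ deltaOne H ≫ (α_ (H ⊗ H) H H).inv ≫
      passenger H (mu H) ▷ H ≫ mulLast H H) ▷ H ≫ passenger H (epsMul H) ≫ (λ_ H).hom := by
        rw [(isHopfAction_self H).coact_act_deltaOne]
    _ = delta H ▷ H ⊗≫ (H ⊗ H) ◁ deltaOne H ▷ H ⊗≫ H ◁ (β_ H H).hom ▷ (H ⊗ H) ⊗≫
        ((mu H ▷ (H ⊗ H)) ▷ H ≫ (H ◁ mu H) ▷ H ≫ passenger H (epsMul H)) ⊗≫ 𝟙 _ := by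
        simp only [passenger, mulLast]; monoidal
    _ = delta H ▷ H ⊗≫ (H ⊗ H) ◁ deltaOne H ▷ H ⊗≫ H ◁ (β_ H H).hom ▷ (H ⊗ H) ⊗≫
        passenger (H ⊗ H) (mu H ▷ H ≫ epsMul H) ⊗≫ mu H := by
        rw [passenger_natural, ← Category.assoc (mu H ▷ (H ⊗ H) ▷ H), whiskerRight_passenger]
        monoidal
    _ = delta H ▷ H ⊗≫ (H ⊗ H) ◁ deltaOne H ▷ H ⊗≫ (H ⊗ H ⊗ H) ◁ (β_ H H).hom ⊗≫
        H ◁ ((β_ H (H ⊗ H)).hom ≫ ((delta H ≫ (β_ H H).inv) ▷ H ≫ (α_ H H H).hom ≫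
          H ◁ epsMul H ≫ (ρ_ H).hom) ▷ H) ▷ H ⊗≫ epsMul H ▷ (H ⊗ H) ⊗≫ mu H := by
        calc _ = delta H ▷ H ⊗≫ (H ⊗ H) ◁ deltaOne H ▷ H ⊗≫ ((H ◁ (β_ H H).hom) ▷ (H ⊗ H) ≫
              (H ⊗ H ⊗ H) ◁ (β_ H H).hom) ⊗≫ (H ⊗ H) ◁ (β_ H H).hom ▷ H ⊗≫
                H ◁ (delta H ≫ (β_ H H).inv) ▷ (H ⊗ H ⊗ H) ⊗≫ H ◁ H ◁ epsMul H ▷ (H ⊗ H) ⊗≫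
                  epsMul H ▷ (H ⊗ H) ⊗≫ mu H := by
              rw [epsMul_mul_eq, passenger, braiding_tensor_left_hom]; monoidal
          _ = _ := by
              rw [← whisker_exchange, braiding_tensor_right_hom]
              monoidal
    _ = delta H ▷ H ⊗≫ (H ⊗ H) ◁ ((λ_ H).inv ≫ deltaOne H ▷ H ≫ (α_ H H H).hom ≫
          H ◁ (β_ H H).hom ≫ (α_ H H H).inv ≫ ((delta H ≫ (β_ H H).inv) ▷ H ≫ (α_ H H H).hom ≫
          H ◁ epsMul H ≫ (ρ_ H).hom) ▷ H) ⊗≫ H ◁ (β_ H H).hom ▷ H ⊗≫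
            epsMul H ▷ (H ⊗ H) ⊗≫ mu H := by
        rw [← braiding_naturality_right]; monoidal
    _ = 𝟙 _ ⊗≫ (delta H ▷ H ≫ (H ⊗ H) ◁ PiL H) ⊗≫ (H ⊗ H) ◁ delta H ⊗≫ H ◁ (β_ H H).hom ▷ H ⊗≫
            epsMul H ▷ (H ⊗ H) ⊗≫ mu H := by
        rw [deltaOne_epsMul_comul]; monoidal
    _ = _ := by
        rw [← whisker_exchange]
        conv_rhs => rw [mul_eq]
        simp only [passenger, mulLast]
        monoidal

/-- `ε((x 1₁) y₁) 1₂ y₂ = ε(x y₁) y₂`. -/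
theorem actDeltaOne_epsMul :
    actDeltaOne (mu H) ▷ H ≫ (H ⊗ H) ◁ delta H ≫ (α_ (H ⊗ H) H H).inv ≫
      passenger H (epsMul H) ▷ H ≫ mulLast H (𝟙_ C) =
    H ◁ delta H ≫ (α_ H H H).inv ≫ epsMul H ▷ H := by
  calc _ = 𝟙 _ ⊗≫ H ◁ deltaOne H ▷ H ⊗≫ (mu H ▷ H ▷ H ≫ (H ⊗ H) ◁ delta H) ⊗≫
        passenger H (epsMul H) ▷ H ⊗≫ mulLast H (𝟙_ C) := by
        simp only [actDeltaOne]; monoidal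
    _ = 𝟙 _ ⊗≫ H ◁ deltaOne H ▷ H ⊗≫ (H ⊗ H ⊗ H) ◁ delta H ⊗≫ (mu H ▷ H ▷ H ≫
        passenger H (epsMul H)) ▷ H ⊗≫ mulLast H (𝟙_ C) := by
        rw [← whisker_exchange]; monoidal
    _ = 𝟙 _ ⊗≫ H ◁ deltaOne H ▷ H ⊗≫ (H ⊗ H ⊗ H) ◁ delta H ⊗≫ H ◁ passenger H (mu H) ▷ H ⊗≫
        (epsMul H ▷ (H ⊗ H) ≫ (𝟙_ C) ◁ mu H) ⊗≫ 𝟙 _ := by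
        rw [whiskerRight_passenger, epsMul_assoc, ← Category.assoc, passenger_comp,
          passenger_whiskerLeft]
        simp only [mulLast]; monoidal
    _ = H ◁ ((λ_ H).inv ≫ deltaOne H ▷ H ≫ (H ⊗ H) ◁ delta H ≫ (α_ (H ⊗ H) H H).inv ≫
      passenger H (mu H) ▷ H ≫ mulLast H H) ⊗≫ epsMul H ▷ H := by
        rw [← whisker_exchange]; simp only [mulLast]; monoidal
    _ = _ := by rw [deltaOne_mul_comul]; monoidal

/-- `Πᴸ(x) y = ε(Πᴸ(x) y₁) y₂`. -/
theorem PiL_mul :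
    PiL H ▷ H ≫ mu H = PiL H ▷ H ≫ H ◁ delta H ≫ (α_ H H H).inv ≫ epsMul H ▷ H ≫ (λ_ H).hom := by
  -- It suffices to treat `1₂` in place of `Πᴸ(x)`. There `1₂ y = ε(1₂ y₁) 1₃ y₂`, and `1₂ ⊗ 1₃` may
  -- be replaced by `1₂ 1'₁ ⊗ 1'₂`, whose second unit is absorbed by `y`.
  apply PiL_ext
  calc _ = (deltaOne H ≫ H ◁ delta H) ▷ H ⊗≫ H ◁ ((H ⊗ H) ◁ delta H ≫ (α_ (H ⊗ H) H H).inv ≫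
      passenger H (epsMul H) ▷ H ≫ mulLast H (𝟙_ C) ≫ (λ_ H).hom) := by
        conv_lhs => rw [mul_eq]
        monoidal
    _ = deltaOne H ▷ H ⊗≫ H ◁ (actDeltaOne (mu H) ▷ H ≫ (H ⊗ H) ◁ delta H ≫
      (α_ (H ⊗ H) H H).inv ≫ passenger H (epsMul H) ▷ H ≫ mulLast H (𝟙_ C)) ⊗≫ 𝟙 _ := by
        rw [← deltaOne_comul, deltaOne_comul_right]
        monoidal
    _ = _ := by rw [actDeltaOne_epsMul]; monoidal

/-- `m₀ · (1₁ x) ⊗ m₁ 1₂ = m₀ · x ⊗ m₁`. -/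
theorem IsHopfAction.coact_act_deltaOneMul {M : C} {ψ : M ⊗ H ⟶ M} {ρ : M ⟶ M ⊗ H}
    (hψ : IsHopfAction ψ ρ) :
    ρ ▷ H ≫ (M ⊗ H) ◁ deltaOneMul H ≫ (α_ (M ⊗ H) H H).inv ≫
      passenger H ψ ▷ H ≫ mulLast H M = ρ ▷ H ≫ passenger H ψ := by
  rw [hψ.passenger_act_eq ρ ρ (delta H) hψ.isRightComodule.coassoc, comul_epsMul, deltaOneMul_eq]
  calc _ = ρ ▷ H ≫ (M ⊗ H) ◁ delta H ⊗≫ (((M ⊗ H) ⊗ H) ◁ PiL H ≫ passenger H ψ ▷ H) ⊗≫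
        M ◁ mu H := by simp only [mulLast]; monoidal
    _ = _ := by rw [whisker_exchange]; monoidal

end HopfAction

/-! ### Coinvariants of a strong Hopf action -/

section Coinvariants

variable {C : Type u} [Category.{v} C] [MonoidalCategory C] [BraidedCategory C]
variable {H : C} [WeakHopfQuasigroup H]

theorem mul_mul_lam :
    H ◁ delta H ≫ (α_ H H H).inv ≫ mu H ▷ H ≫ H ◁ lam H ≫ mu H = H ◁ PiL H ≫ mu H := by
  rw [PiL, lam, ← WeakHopfQuasigroup.mul_mul_antipode, MonoidalCategory.tensorHom_def]
  simp

theorem PiR_eq : PiR H = (ρ_ H).inv ≫ H ◁ deltaOne H ≫ (α_ H H H).inv ≫ (β_ H H).hom ▷ H ≫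
    (α_ H H H).hom ≫ H ◁ epsMul H ≫ (ρ_ H).hom :=
  WeakHopfQuasigroup.antipode_conv_id

/-- On a coinvariant `n`, `(n · b)₀ ⊗ (n · b)₁ = n · b₀ ⊗ b₁`. -/
theorem coact_act_of_coinvariant {M B N : C} {ρ : M ⟶ M ⊗ H} (hρ : IsRightComodule ρ)
    {ρB : B ⟶ B ⊗ H} (hρB : IsRightComodule ρB) {φ : M ⊗ B ⟶ M}
    (hφ : φ ≫ ρ = ρ ▷ B ≫ (M ⊗ H) ◁ ρB ≫ (α_ (M ⊗ H) B H).inv ≫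
      passenger H φ ▷ H ≫ mulLast H M)
    {i : N ⟶ M} {w : N ⟶ M ⊗ H} (hw : i ≫ ρ = w ≫ M ◁ PiL H) :
    (i ▷ B ≫ φ) ≫ ρ = i ▷ B ≫ M ◁ ρB ≫ (α_ M B H).inv ≫ φ ▷ H := by
  -- Since `n₁` lies in the image of `Πᴸ`, the product `n₁ b₁` becomes `ε(n₁ b₁) b₂` by `PiL_mul`.
  -- What remains below is to read `n₀ · b₀ ε(n₁ b₁)` as `(M ⊗ ε) ∘ ρ` applied to `n · b₀`.
  have key : i ▷ B ≫ φ ≫ ρ = (i ≫ ρ) ▷ B ⊗≫ (M ⊗ H) ◁ ρB ⊗≫ passenger H φ ▷ H ⊗≫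
      (M ⊗ H) ◁ delta H ⊗≫ M ◁ epsMul H ▷ H ⊗≫ 𝟙 _ := by
    calc _ = (i ≫ ρ) ▷ B ≫ (M ⊗ H) ◁ ρB ≫ (α_ (M ⊗ H) B H).inv ≫
        passenger H φ ▷ H ≫ mulLast H M := by rw [hφ]; simp
      _ = w ▷ B ⊗≫ ((M ◁ PiL H) ▷ B ≫ (M ⊗ H) ◁ ρB) ⊗≫ passenger H φ ▷ H ⊗≫ M ◁ mu H := by
        rw [hw]; simp only [mulLast]; monoidal
      _ = w ▷ B ⊗≫ (M ⊗ H) ◁ ρB ⊗≫ ((M ◁ PiL H) ▷ B ≫ passenger H φ) ▷ H ⊗≫ M ◁ mu H := by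
        rw [← whisker_exchange]; monoidal
      _ = w ▷ B ⊗≫ (M ⊗ H) ◁ ρB ⊗≫ passenger H φ ▷ H ⊗≫ M ◁ (PiL H ▷ H ≫ mu H) := by
        rw [passenger_natural]; monoidal
      _ = w ▷ B ⊗≫ (M ⊗ H) ◁ ρB ⊗≫ (passenger H φ ≫ M ◁ PiL H) ▷ H ⊗≫ (M ⊗ H) ◁ delta H ⊗≫
          M ◁ epsMul H ▷ H ⊗≫ 𝟙 _ := by
        rw [PiL_mul]; monoidal
      _ = w ▷ B ⊗≫ ((M ⊗ H) ◁ ρB ≫ (M ◁ PiL H) ▷ (B ⊗ H)) ⊗≫ passenger H φ ▷ H ⊗≫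
          (M ⊗ H) ◁ delta H ⊗≫ M ◁ epsMul H ▷ H ⊗≫ 𝟙 _ := by
        rw [← passenger_natural]; monoidal
      _ = _ := by rw [whisker_exchange, hw]; monoidal
  rw [Category.assoc, key]
  calc _ = (i ≫ ρ) ▷ B ⊗≫ (M ⊗ H) ◁ ρB ⊗≫ (passenger H φ ▷ H ≫
      (M ⊗ H) ◁ delta H) ⊗≫ M ◁ epsMul H ▷ H ⊗≫ 𝟙 _ := by monoidal
    _ = (i ≫ ρ) ▷ B ⊗≫ (M ⊗ H) ◁ (ρB ≫ B ◁ delta H ≫ (α_ B H H).inv) ⊗≫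
        (passenger H φ ▷ H ⊗≫ M ◁ epsMul H) ▷ H ⊗≫ 𝟙 _ := by
      rw [← whisker_exchange]; monoidal
    _ = i ▷ B ⊗≫ (ρ ▷ B ≫ (M ⊗ H) ◁ ρB) ⊗≫ (M ⊗ H) ◁ ρB ▷ H ⊗≫
        (passenger H φ ▷ H ⊗≫ M ◁ epsMul H) ▷ H ⊗≫ 𝟙 _ := by
      rw [← hρB.coassoc]; monoidal
    _ = i ▷ B ⊗≫ M ◁ ρB ⊗≫ (ρ ▷ B ≫ (M ⊗ H) ◁ ρB ≫ (α_ (M ⊗ H) B H).inv ≫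
      passenger H φ ▷ H ≫ (α_ M H H).hom ≫ M ◁ epsMul H) ▷ H ⊗≫ 𝟙 _ := by
      rw [← whisker_exchange]; monoidal
    _ = i ▷ B ⊗≫ M ◁ ρB ⊗≫ (φ ≫ ρ ≫ M ◁ eps H) ▷ H ⊗≫ 𝟙 _ := by
      rw [← mulLast_counit, reassoc_of% hφ]
    _ = _ := by rw [hρ.counit]; monoidal

/-- A Hopf action that satisfies the two cancellation laws for the antipode. -/
structure IsStrongHopfAction {M : C} (ψ : M ⊗ H ⟶ M) (ρ : M ⟶ M ⊗ H) : Prop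
    extends IsHopfAction ψ ρ where
  act_act_antipode :
    M ◁ delta H ≫ (α_ M H H).inv ≫ ψ ▷ H ≫ M ◁ lam H ≫ ψ = M ◁ PiL H ≫ ψ
  act_antipode_act :
    M ◁ delta H ≫ (α_ M H H).inv ≫ (M ◁ lam H ≫ ψ) ▷ H ≫ ψ = M ◁ PiR H ≫ ψ

/-- `m ↦ m₀ · λ(m₁)`. -/
def coinvProj {M : C} (ψ : M ⊗ H ⟶ M) (ρ : M ⟶ M ⊗ H) : M ⟶ M := ρ ≫ M ◁ lam H ≫ ψ

namespace IsStrongHopfAction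

variable {M : C} {ψ : M ⊗ H ⟶ M} {ρ : M ⟶ M ⊗ H}

/-- `m₀ · Πᴿ(m₁) = m`. -/
theorem act_PiR (hψ : IsHopfAction ψ ρ) : ρ ≫ M ◁ PiR H ≫ ψ = 𝟙 M := by
  calc _ = ρ ⊗≫ (M ⊗ H) ◁ deltaOne H ⊗≫ M ◁ (β_ H H).hom ▷ H ⊗≫
      ((M ⊗ H) ◁ epsMul H ≫ ψ ▷ 𝟙_ C) ⊗≫ 𝟙 _ := by rw [PiR_eq]; monoidal
    _ = 𝟙 _ ⊗≫ ((ρ_ M).inv ≫ ρ ▷ 𝟙_ C ≫ (M ⊗ H) ◁ deltaOne H ≫ (α_ (M ⊗ H) H H).inv ≫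
      passenger H ψ ▷ H ≫ mulLast H M) ≫ M ◁ eps H ⊗≫ 𝟙 _ := by
      rw [whisker_exchange]; simp only [epsMul, mulLast, passenger]; monoidal
    _ = 𝟙 _ ⊗≫ (ρ ≫ M ◁ eps H) ⊗≫ 𝟙 _ := by rw [hψ.coact_act_deltaOne]; monoidal
    _ = 𝟙 M := by rw [hψ.isRightComodule.counit]; monoidal

/-- `q(m₀) · m₁ = m`. -/
theorem coinvProj_act (hψ : IsStrongHopfAction ψ ρ) : ρ ≫ coinvProj ψ ρ ▷ H ≫ ψ = 𝟙 M := by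
  calc _ = (ρ ≫ ρ ▷ H) ≫ (M ◁ lam H ≫ ψ) ▷ H ≫ ψ := by simp [coinvProj]
    _ = 𝟙 M := by
      rw [hψ.isRightComodule.coassoc, Category.assoc, Category.assoc, hψ.act_antipode_act,
        act_PiR hψ.toIsHopfAction]

/-- `q(m₀) · Πᴸ(m₁) = q(m)`. -/
theorem coinvProj_act_PiL (hψ : IsStrongHopfAction ψ ρ) :
    ρ ≫ coinvProj ψ ρ ▷ H ≫ M ◁ PiL H ≫ ψ = coinvProj ψ ρ := by
  symm
  -- Substitute `m₀ = q(m₀₀) · m₀₁` into `m₀ · λ(m₁)`; after coassociativity the first cancellation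
  -- law applies.
  calc coinvProj ψ ρ = ρ ≫ (ρ ≫ coinvProj ψ ρ ▷ H ≫ ψ) ▷ H ≫ M ◁ lam H ≫ ψ := by
        rw [hψ.coinvProj_act]; simp [coinvProj]
    _ = (ρ ≫ ρ ▷ H) ⊗≫ coinvProj ψ ρ ▷ H ▷ H ≫ ψ ▷ H ≫ M ◁ lam H ≫ ψ := by monoidal
    _ = ρ ⊗≫ (M ◁ delta H ≫ coinvProj ψ ρ ▷ (H ⊗ H)) ⊗≫ ψ ▷ H ≫ M ◁ lam H ≫ ψ := by
        rw [hψ.isRightComodule.coassoc]; monoidal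
    _ = ρ ≫ coinvProj ψ ρ ▷ H ≫ (M ◁ delta H ≫ (α_ M H H).inv ≫ ψ ▷ H ≫ M ◁ lam H ≫ ψ) := by
        rw [whisker_exchange]; monoidal
    _ = _ := by rw [hψ.act_act_antipode]

/-- Apply `ρ` to `q(m) = q(m₀) · Πᴸ(m₁)`: the coproduct of `Πᴸ(m₁)` is `1₁ Πᴸ(m₁) ⊗ 1₂`, and
`coact_act_deltaOneMul` absorbs the unit. -/
theorem coinvProj_coact (hψ : IsStrongHopfAction ψ ρ) :
    coinvProj ψ ρ ≫ ρ =
      ρ ≫ (coinvProj ψ ρ ≫ ρ) ▷ H ≫ (M ⊗ H) ◁ PiL H ≫ passenger H ψ := by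
  calc coinvProj ψ ρ ≫ ρ = ρ ≫ coinvProj ψ ρ ▷ H ≫ M ◁ PiL H ≫ ψ ≫ ρ := by
        conv_lhs => rw [← hψ.coinvProj_act_PiL]
        simp
    _ = ρ ≫ coinvProj ψ ρ ▷ H ≫ (M ◁ PiL H ≫ ρ ▷ H) ≫ (M ⊗ H) ◁ delta H ≫
        (α_ (M ⊗ H) H H).inv ≫ passenger H ψ ▷ H ≫ mulLast H M := by
        rw [hψ.act_coact]; simp
    _ = ρ ≫ (coinvProj ψ ρ ≫ ρ) ▷ H ≫ (M ⊗ H) ◁ (PiL H ≫ delta H) ≫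
        (α_ (M ⊗ H) H H).inv ≫ passenger H ψ ▷ H ≫ mulLast H M := by
        rw [whisker_exchange]; simp
    _ = ρ ≫ coinvProj ψ ρ ▷ H ≫ (ρ ▷ H ≫ (M ⊗ H) ◁ PiL H) ≫ (M ⊗ H) ◁ deltaOneMul H ≫
        (α_ (M ⊗ H) H H).inv ≫ passenger H ψ ▷ H ≫ mulLast H M := by
        rw [PiL_comul]; simp
    _ = ρ ≫ coinvProj ψ ρ ▷ H ≫ M ◁ PiL H ≫ (ρ ▷ H ≫ (M ⊗ H) ◁ deltaOneMul H ≫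
        (α_ (M ⊗ H) H H).inv ≫ passenger H ψ ▷ H ≫ mulLast H M) := by
        rw [← whisker_exchange]; simp
    _ = ρ ≫ coinvProj ψ ρ ▷ H ≫ (M ◁ PiL H ≫ ρ ▷ H) ≫ passenger H ψ := by
        rw [hψ.coact_act_deltaOneMul]; simp
    _ = _ := by rw [whisker_exchange]; simp

/-- `m₀ ⊗ Πᴸ(m₁) = q(m₀)₀ · m₁ ⊗ q(m₀)₁`. -/
theorem coact_PiL (hψ : IsStrongHopfAction ψ ρ) :
    ρ ≫ M ◁ PiL H = ρ ≫ (coinvProj ψ ρ ≫ ρ) ▷ H ≫ passenger H ψ := by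
  -- Compute `ρ(m)` from `m = q(m₀) · m₁`. In `Πᴸ(m₁) = m₁ λ(m₂)` this produces a product `(x y₁)
  -- λ(y₂)`, which (a4-6) turns into `x Πᴸ(y)` without associativity.
  have h1 : ρ = ρ ≫ (coinvProj ψ ρ ≫ ρ) ▷ H ≫ (M ⊗ H) ◁ delta H ≫
      (α_ (M ⊗ H) H H).inv ≫ passenger H ψ ▷ H ≫ mulLast H M := by
    calc ρ = (ρ ≫ coinvProj ψ ρ ▷ H ≫ ψ) ≫ ρ := by rw [hψ.coinvProj_act, Category.id_comp]
      _ = _ := by simp [hψ.act_coact]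
  have h2 : ρ ≫ M ◁ PiL H = (ρ ≫ ρ ▷ H) ⊗≫ (M ⊗ H) ◁ lam H ⊗≫ M ◁ mu H := by
    rw [hψ.isRightComodule.coassoc]
    simp only [PiL, conv, MonoidalCategory.tensorHom_def]
    monoidal
  calc _ = ρ ⊗≫ (ρ ≫ (coinvProj ψ ρ ≫ ρ) ▷ H ≫ (M ⊗ H) ◁ delta H ≫
      (α_ (M ⊗ H) H H).inv ≫ passenger H ψ ▷ H ≫ mulLast H M) ▷ H ⊗≫ (M ⊗ H) ◁ lam H ⊗≫
        M ◁ mu H := by rw [h2, ← h1]; monoidal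
    _ = (ρ ≫ ρ ▷ H) ⊗≫ (coinvProj ψ ρ ≫ ρ) ▷ H ▷ H ⊗≫ (M ⊗ H) ◁ delta H ▷ H ⊗≫
      passenger H ψ ▷ H ▷ H ⊗≫ M ◁ mu H ▷ H ⊗≫ (M ⊗ H) ◁ lam H ⊗≫ M ◁ mu H := by
        simp only [mulLast]; monoidal
    _ = ρ ⊗≫ (M ◁ delta H ≫ (coinvProj ψ ρ ≫ ρ) ▷ (H ⊗ H)) ⊗≫ (M ⊗ H) ◁ delta H ▷ H ⊗≫
      passenger H ψ ▷ H ▷ H ⊗≫ M ◁ mu H ▷ H ⊗≫ (M ⊗ H) ◁ lam H ⊗≫ M ◁ mu H := by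
        rw [hψ.isRightComodule.coassoc]; monoidal
    _ = ρ ⊗≫ (coinvProj ψ ρ ≫ ρ) ▷ H ⊗≫ (M ⊗ H) ◁ (delta H ≫ delta H ▷ H) ⊗≫
      passenger H ψ ▷ H ▷ H ⊗≫ M ◁ mu H ▷ H ⊗≫ (M ⊗ H) ◁ lam H ⊗≫ M ◁ mu H := by
        rw [whisker_exchange]; monoidal
    _ = ρ ⊗≫ (coinvProj ψ ρ ≫ ρ) ▷ H ⊗≫ (M ⊗ H) ◁ delta H ⊗≫ (((M ⊗ H) ⊗ H) ◁ delta H ≫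
      passenger H ψ ▷ (H ⊗ H)) ⊗≫ M ◁ mu H ▷ H ⊗≫ (M ⊗ H) ◁ lam H ⊗≫ M ◁ mu H := by
        have h3 : delta H ≫ delta H ▷ H = delta H ≫ H ◁ delta H ≫ (α_ H H H).inv :=
          (isHopfAction_self H).isRightComodule.coassoc
        rw [h3]; monoidal
    _ = ρ ⊗≫ (coinvProj ψ ρ ≫ ρ) ▷ H ⊗≫ (M ⊗ H) ◁ delta H ⊗≫ passenger H ψ ▷ H ⊗≫
      M ◁ (H ◁ delta H ≫ (α_ H H H).inv ≫ mu H ▷ H ≫ H ◁ lam H ≫ mu H) := by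
        rw [whisker_exchange]; monoidal
    _ = ρ ⊗≫ (coinvProj ψ ρ ≫ ρ) ▷ H ⊗≫ (M ⊗ H) ◁ delta H ⊗≫ (passenger H ψ ▷ H ≫
      (M ⊗ H) ◁ PiL H) ⊗≫ M ◁ mu H := by
        rw [mul_mul_lam]; monoidal
    _ = ρ ⊗≫ coinvProj ψ ρ ▷ H ⊗≫ (ρ ▷ H ≫ (M ⊗ H) ◁ deltaOneMul H ≫
        (α_ (M ⊗ H) H H).inv ≫ passenger H ψ ▷ H ≫ mulLast H M) := by
        rw [← whisker_exchange, deltaOneMul_eq]; simp only [mulLast]; monoidal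
    _ = _ := by rw [hψ.coact_act_deltaOneMul]; monoidal

/-- `q(m)₀ ⊗ q(m)₁ = m₀ · λ(m₂) ⊗ Πᴸ(m₁)`. -/
theorem coinvProj_coact_eq (hψ : IsStrongHopfAction ψ ρ) :
    coinvProj ψ ρ ≫ ρ = (ρ ≫ ρ ▷ H ≫ (M ⊗ H) ◁ lam H ≫ passenger H ψ) ≫ M ◁ PiL H := by
  symm
  calc _ = ρ ≫ ρ ▷ H ≫ ((M ⊗ H) ◁ lam H ≫ (M ◁ PiL H) ▷ H) ≫ passenger H ψ := by
        simp only [Category.assoc]; rw [passenger_natural]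
    _ = ρ ≫ (ρ ≫ M ◁ PiL H) ▷ H ≫ (M ⊗ H) ◁ lam H ≫ passenger H ψ := by
        rw [whisker_exchange]; simp
    _ = (ρ ≫ ρ ▷ H) ⊗≫ (coinvProj ψ ρ ≫ ρ) ▷ H ▷ H ⊗≫ passenger H ψ ▷ H ≫
        (M ⊗ H) ◁ lam H ≫ passenger H ψ := by
        rw [hψ.coact_PiL]; monoidal
    _ = ρ ⊗≫ (M ◁ delta H ≫ (coinvProj ψ ρ ≫ ρ) ▷ (H ⊗ H)) ⊗≫ passenger H ψ ▷ H ≫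
        (M ⊗ H) ◁ lam H ≫ passenger H ψ := by
        rw [hψ.isRightComodule.coassoc]; monoidal
    _ = ρ ≫ (coinvProj ψ ρ ≫ ρ) ▷ H ≫ (M ⊗ H) ◁ delta H ≫ (α_ (M ⊗ H) H H).inv ≫
        passenger H ψ ▷ H ≫ (M ⊗ H) ◁ lam H ≫ passenger H ψ := by
        rw [whisker_exchange]; monoidal
    _ = _ := by
        rw [whiskerLeft_passenger H ψ (lam H), ← passenger_associator_inv,
          whiskerLeft_passenger, hψ.act_act_antipode, ← whiskerLeft_passenger,
          ← hψ.coinvProj_coact]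

/-- Coinvariants are fixed by `q`. -/
theorem comp_coinvProj (hψ : IsStrongHopfAction ψ ρ) {N : C} {i : N ⟶ M} {w : N ⟶ M ⊗ H}
    (hw : i ≫ ρ = w ≫ M ◁ PiL H) : i ≫ coinvProj ψ ρ = i := by
  have h := coact_act_of_coinvariant hψ.isRightComodule
    (isHopfAction_self H).isRightComodule hψ.act_coact hw
  -- Writing `n = n · 1` makes `ρ(n) = n · 1₁ ⊗ 1₂`, whence `q(n) = (n · 1₁) · λ(1₂) = n · Πᴸ(1) =
  -- n`.
  have h1 : (ρ_ N).inv ≫ N ◁ eta H ≫ i ▷ H ≫ ψ = i := by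
    rw [whisker_exchange_assoc, hψ.act_one]; simp
  calc _ = (ρ_ N).inv ≫ N ◁ eta H ≫ ((i ▷ H ≫ ψ) ≫ ρ) ≫ M ◁ lam H ≫ ψ := by
        rw [coinvProj]
        conv_lhs => rw [← h1]
        simp
    _ = (ρ_ N).inv ≫ (N ◁ eta H ≫ i ▷ H) ≫ M ◁ delta H ≫ (α_ M H H).inv ≫ ψ ▷ H ≫
        M ◁ lam H ≫ ψ := by rw [h]; simp
    _ = (ρ_ N).inv ≫ i ▷ 𝟙_ C ≫ M ◁ (eta H ≫ PiL H) ≫ ψ := by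
        rw [hψ.act_act_antipode, whisker_exchange]; simp
    _ = i := by rw [eta_PiL, hψ.act_one]; simp

theorem coinvProj_idem (hψ : IsStrongHopfAction ψ ρ) :
    coinvProj ψ ρ ≫ coinvProj ψ ρ = coinvProj ψ ρ :=
  hψ.comp_coinvProj hψ.coinvProj_coact_eq

end IsStrongHopfAction

end Coinvariants

/-! ### Strong Hopf modules and their coinvariants -/

section HopfModules

variable {C : Type u} [Category.{v} C] [MonoidalCategory C] [BraidedCategory C]
variable {H B : C} [WeakHopfQuasigroup H] [UnitalMagmaObj B] [ComoduleMagma H B] {h : H ⟶ B}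

variable (H B) in
theorem mul_rho :
    mu B ≫ rho H B = rho H B ▷ B ≫ (B ⊗ H) ◁ rho H B ≫ (α_ (B ⊗ H) B H).inv ≫
      passenger H (mu B) ▷ H ≫ mulLast H B := by
  rw [← ComoduleMagma.mul_coact, tensorHom_tensorμ_mul]

theorem coinvEnd_eq {M : C} (φ : M ⊗ B ⟶ M) (ρ : M ⟶ M ⊗ H) :
    coinvEnd h φ ρ = coinvProj (M ◁ h ≫ φ) ρ := by
  simp [coinvEnd, coinvProj]

/-- Restriction of the action along `h`. Axiom (d2-2) is not among the hypotheses, so the result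
covers `B` itself before any choice of `B^{coH}`, as well as every strong Hopf module. -/
theorem IsAnchor.isStrongHopfAction (hh : IsAnchor h) {M : C} {φ : M ⊗ B ⟶ M} {ρ : M ⟶ M ⊗ H}
    (hρ : IsRightComodule ρ) (act_one : M ◁ eta B ≫ φ = (ρ_ M).hom)
    (act_coact : φ ≫ ρ = ρ ▷ B ≫ (M ⊗ H) ◁ rho H B ≫ (α_ (M ⊗ H) B H).inv ≫
      passenger H φ ▷ H ≫ mulLast H M)
    (act_act_antipode :
      M ◁ delta H ≫ (α_ M H H).inv ≫ ((M ◁ h ≫ φ) ⊗ₘ (lam H ≫ h)) ≫ φ = M ◁ (PiL H ≫ h) ≫ φ)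
    (act_antipode_act :
      M ◁ delta H ≫ (α_ M H H).inv ≫ ((M ◁ (lam H ≫ h) ≫ φ) ⊗ₘ h) ≫ φ = M ◁ (PiR H ≫ h) ≫ φ) :
    IsStrongHopfAction (M ◁ h ≫ φ) ρ where
  isRightComodule := hρ
  act_one := by rw [← whiskerLeft_comp_assoc, hh.map_one, act_one]
  act_coact := by
    have hc : delta H ≫ h ▷ H = h ≫ rho H B := hh.colinear
    calc _ = (M ◁ h ≫ ρ ▷ B) ≫ (M ⊗ H) ◁ rho H B ≫ (α_ (M ⊗ H) B H).inv ≫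
        passenger H φ ▷ H ≫ mulLast H M := by rw [Category.assoc, act_coact]; simp
      _ = ρ ▷ H ≫ (M ⊗ H) ◁ (h ≫ rho H B) ≫ (α_ (M ⊗ H) B H).inv ≫
        passenger H φ ▷ H ≫ mulLast H M := by rw [whisker_exchange]; simp
      _ = ρ ▷ H ⊗≫ (M ⊗ H) ◁ delta H ⊗≫ ((M ⊗ H) ◁ h ≫ passenger H φ) ▷ H ≫ mulLast H M := by
        rw [← hc]; monoidal
      _ = _ := by rw [whiskerLeft_passenger]; monoidal
  act_act_antipode := by
    rw [whiskerLeft_comp, Category.assoc, MonoidalCategory.tensorHom_def] at act_act_antipode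
    simpa using act_act_antipode
  act_antipode_act := by
    rw [whiskerLeft_comp, Category.assoc, MonoidalCategory.tensorHom_def] at act_antipode_act
    simpa using act_antipode_act

theorem IsAnchor.isStrongHopfAction_self (hh : IsAnchor h) :
    IsStrongHopfAction (B ◁ h ≫ mu B) (rho H B) :=
  hh.isStrongHopfAction ComoduleMagma.isRightComodule UnitalMagmaObj.mul_one (mul_rho H B)
    hh.mul_mul_antipode hh.mul_antipode_mul

theorem IsAnchor.nonempty_coinvImage [IsIdempotentComplete C] (hh : IsAnchor h) :
    Nonempty (CoinvImage h) := by
  obtain ⟨Y, i, p, h1, h2⟩ := IsIdempotentComplete.idempotents_split B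
    (coinvEnd h (mu B) (rho H B)) (by
      rw [coinvEnd_eq]; exact hh.isStrongHopfAction_self.coinvProj_idem)
  exact ⟨⟨Y, i, p, h1, h2⟩⟩

variable {b : CoinvImage h}

theorem IsStrongHopfModule.act_coact_eq {M : C} {φ : M ⊗ B ⟶ M} {ρ : M ⟶ M ⊗ H}
    (hM : IsStrongHopfModule b φ ρ) :
    φ ≫ ρ = ρ ▷ B ≫ (M ⊗ H) ◁ rho H B ≫ (α_ (M ⊗ H) B H).inv ≫
      passenger H φ ▷ H ≫ mulLast H M := by
  rw [hM.act_coact, tensorHom_tensorμ_mul]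

theorem IsStrongHopfModule.isStrongHopfAction {M : C} {φ : M ⊗ B ⟶ M} {ρ : M ⟶ M ⊗ H}
    (hM : IsStrongHopfModule b φ ρ) (hh : IsAnchor h) : IsStrongHopfAction (M ◁ h ≫ φ) ρ :=
  hh.isStrongHopfAction hM.isRightComodule hM.act_one hM.act_coact_eq hM.act_act_antipode
    hM.act_antipode_act

theorem IsStrongHopfAction.coinvariant {M N : C} {ψ : M ⊗ H ⟶ M} {ρ : M ⟶ M ⊗ H}
    (hψ : IsStrongHopfAction ψ ρ) {i : N ⟶ M} {p : M ⟶ N} (ip : i ≫ p = 𝟙 N)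
    (pi : p ≫ i = coinvProj ψ ρ) : ∃ w : N ⟶ M ⊗ H, i ≫ ρ = w ≫ M ◁ PiL H :=
  ⟨i ≫ ρ ≫ ρ ▷ H ≫ (M ⊗ H) ◁ lam H ≫ passenger H ψ, by
    rw [Category.assoc, ← hψ.coinvProj_coact_eq, ← pi, Category.assoc, reassoc_of% ip]⟩

/-- `(i_B(c) b)₀ ⊗ (i_B(c) b)₁ = i_B(c) b₀ ⊗ b₁`. -/
theorem IsAnchor.ι_mul_rho (hh : IsAnchor h) (b : CoinvImage h) :
    (b.ι ▷ B ≫ mu B) ≫ rho H B =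
      b.ι ▷ B ≫ B ◁ rho H B ≫ (α_ B B H).inv ≫ mu B ▷ H := by
  obtain ⟨w, hw⟩ := hh.isStrongHopfAction_self.coinvariant b.ι_π (b.π_ι.trans (coinvEnd_eq _ _))
  exact coact_act_of_coinvariant ComoduleMagma.isRightComodule ComoduleMagma.isRightComodule
    (mul_rho H B) hw

/-- `q_B(b₀) h(b₁) = b`. -/
theorem IsAnchor.coinvEnd_mul (hh : IsAnchor h) (b : CoinvImage h) :
    rho H B ≫ (b.π ≫ b.ι) ▷ H ≫ B ◁ h ≫ mu B = 𝟙 B := by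
  rw [b.π_ι, coinvEnd_eq]
  exact hh.isStrongHopfAction_self.coinvProj_act

/-- `q_B(b₀) h(Πᴸ(b₁)) = q_B(b)`. -/
theorem IsAnchor.coinvEnd_mul_PiL (hh : IsAnchor h) (b : CoinvImage h) :
    rho H B ≫ (b.π ≫ b.ι) ▷ H ≫ B ◁ (PiL H ≫ h) ≫ mu B = b.π ≫ b.ι := by
  rw [b.π_ι, coinvEnd_eq, whiskerLeft_comp, Category.assoc]
  exact hh.isStrongHopfAction_self.coinvProj_act_PiL

section Module

variable {M N : C} {φ : M ⊗ B ⟶ M} {ρ : M ⟶ M ⊗ H} {i : N ⟶ M} {p : M ⟶ N}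

theorem IsStrongHopfModule.coinv_act_coact (hM : IsStrongHopfModule b φ ρ) (hh : IsAnchor h)
    (ip : i ≫ p = 𝟙 N) (pi : p ≫ i = coinvEnd h φ ρ) :
    (i ▷ B ≫ φ) ≫ ρ = i ▷ B ≫ M ◁ rho H B ≫ (α_ M B H).inv ≫ φ ▷ H := by
  obtain ⟨w, hw⟩ := (hM.isStrongHopfAction hh).coinvariant ip (pi.trans (coinvEnd_eq _ _))
  exact coact_act_of_coinvariant hM.isRightComodule ComoduleMagma.isRightComodule
    hM.act_coact_eq hw

theorem IsStrongHopfModule.act_coinvEnd_act (hM : IsStrongHopfModule b φ ρ) :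
    (M ◁ (b.π ≫ b.ι) ≫ φ) ▷ B ≫ φ = (α_ M B B).hom ≫ M ◁ ((b.π ≫ b.ι) ▷ B ≫ mu B) ≫ φ := by
  calc _ = (M ◁ b.π) ▷ B ≫ (M ◁ b.ι ≫ φ) ▷ B ≫ φ := by monoidal
    _ = _ := by rw [hM.act_act]; monoidal

/-- `q_M(n · b) = n · q_B(b)` for a coinvariant `n`. -/
theorem IsStrongHopfModule.coinv_act_coinvEnd (hM : IsStrongHopfModule b φ ρ) (hh : IsAnchor h)
    (ip : i ≫ p = 𝟙 N) (pi : p ≫ i = coinvEnd h φ ρ) :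
    i ▷ B ≫ φ ≫ coinvEnd h φ ρ = i ▷ B ≫ M ◁ (b.π ≫ b.ι) ≫ φ := by
  have e1 := hh.coinvEnd_mul b
  have e2 := hh.coinvEnd_mul_PiL b
  have e3 := hM.act_coinvEnd_act
  generalize b.π ≫ b.ι = q at *
  have h2 : M ◁ delta H ≫ (α_ M H H).inv ≫ (M ◁ h ≫ φ) ▷ H ≫ M ◁ lam H ≫ M ◁ h ≫ φ =
    M ◁ PiL H ≫ M ◁ h ≫ φ := (hM.isStrongHopfAction hh).act_act_antipode
  have h3 : rho H B ≫ rho H B ▷ H = rho H B ≫ B ◁ delta H ≫ (α_ B H H).inv :=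
    ComoduleMagma.isRightComodule.coassoc
  -- With `ρ(n · b) = n · b₀ ⊗ b₁` and `b = q_B(b₀) h(b₁)`, (d2-2) rebrackets to `((n · q_B(b₀)) ·
  -- h(b₁)) · h(λ(b₂))`. The cancellation law gives `(n · q_B(b₀)) · h(Πᴸ(b₁))`, and (d2-2) is then
  -- used backwards.
  calc _ = i ▷ B ≫ M ◁ rho H B ≫ (α_ M B H).inv ≫ φ ▷ H ≫ M ◁ (lam H ≫ h) ≫ φ := by
        rw [coinvEnd, ← Category.assoc φ, ← Category.assoc (i ▷ B), ← Category.assoc (i ▷ B),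
          hM.coinv_act_coact hh ip pi]
        simp
    _ = i ▷ B ⊗≫ M ◁ (rho H B ≫ (rho H B ≫ q ▷ H ≫ B ◁ h ≫ mu B) ▷ H) ⊗≫ φ ▷ H ≫
        M ◁ (lam H ≫ h) ≫ φ := by rw [e1]; monoidal
    _ = i ▷ B ⊗≫ M ◁ ((rho H B ≫ rho H B ▷ H) ≫ ((q ▷ H ≫ B ◁ h) ≫ mu B) ▷ H) ⊗≫ φ ▷ H ≫
        M ◁ (lam H ≫ h) ≫ φ := by monoidal
    _ = i ▷ B ⊗≫ M ◁ (rho H B ≫ B ◁ delta H) ⊗≫ ((M ⊗ B) ◁ h ≫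
        (α_ M B B).hom ≫ M ◁ (q ▷ B ≫ mu B) ≫ φ) ▷ H ≫ M ◁ (lam H ≫ h) ≫ φ := by
      rw [h3, ← whisker_exchange]; monoidal
    _ = i ▷ B ⊗≫ M ◁ (rho H B ≫ B ◁ delta H) ⊗≫ (((M ⊗ B) ◁ h ≫
        (M ◁ q ≫ φ) ▷ B) ≫ φ) ▷ H ≫ M ◁ (lam H ≫ h) ≫ φ := by
      rw [← e3]; monoidal
    _ = i ▷ B ⊗≫ M ◁ rho H B ⊗≫ ((M ⊗ B) ◁ delta H ≫ (M ◁ q ≫ φ) ▷ (H ⊗ H)) ⊗≫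
        (M ◁ h ≫ φ) ▷ H ≫ M ◁ (lam H ≫ h) ≫ φ := by
      rw [whisker_exchange]; monoidal
    _ = i ▷ B ⊗≫ M ◁ rho H B ⊗≫ (M ◁ q ≫ φ) ▷ H ⊗≫ (M ◁ delta H ≫ (α_ M H H).inv ≫
        (M ◁ h ≫ φ) ▷ H ≫ M ◁ lam H ≫ M ◁ h ≫ φ) := by
      rw [whisker_exchange]; monoidal
    _ = i ▷ B ⊗≫ M ◁ rho H B ⊗≫ ((M ◁ q ≫ φ) ▷ H ≫ M ◁ (PiL H ≫ h)) ⊗≫ φ := by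
      rw [h2]; monoidal
    _ = i ▷ B ⊗≫ M ◁ rho H B ⊗≫ (M ⊗ B) ◁ (PiL H ≫ h) ⊗≫ ((M ◁ q ≫ φ) ▷ B ≫ φ) := by
      rw [← whisker_exchange]; monoidal
    _ = i ▷ B ⊗≫ M ◁ (rho H B ≫ (B ◁ (PiL H ≫ h) ≫ q ▷ B) ≫ mu B) ≫ φ := by
      rw [e3]; monoidal
    _ = i ▷ B ⊗≫ M ◁ (rho H B ≫ q ▷ H ≫ B ◁ (PiL H ≫ h) ≫ mu B) ≫ φ := by
      rw [whisker_exchange]; monoidal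
    _ = _ := by rw [e2]; monoidal

/-- `p_M(n · b) = φ_{M^{coH}}(n ⊗ p_B(b))` for a coinvariant `n`. -/
theorem IsStrongHopfModule.coinv_act_proj (hM : IsStrongHopfModule b φ ρ) (hh : IsAnchor h)
    (ip : i ≫ p = 𝟙 N) (pi : p ≫ i = coinvEnd h φ ρ) {φN : N ⊗ b.obj ⟶ N}
    (hφN : φN ≫ i = (i ⊗ₘ b.ι) ≫ φ) : i ▷ B ≫ φ ≫ p = N ◁ b.π ≫ φN := by
  have : Mono i := mono_of_mono_fac ip
  rw [← cancel_mono i]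
  calc _ = i ▷ B ≫ φ ≫ p ≫ i := by simp
    _ = i ▷ B ≫ M ◁ (b.π ≫ b.ι) ≫ φ := by rw [pi, hM.coinv_act_coinvEnd hh ip pi]
    _ = N ◁ b.π ≫ (i ⊗ₘ b.ι) ≫ φ := by
      rw [MonoidalCategory.tensorHom_def']
      rw [← whisker_exchange_assoc]; simp
    _ = _ := by rw [← hφN, Category.assoc]

/-- The action of `B^{coH}` on `M^{coH}`. -/
theorem IsStrongHopfModule.exists_coinv_act (hM : IsStrongHopfModule b φ ρ) (hh : IsAnchor h)
    (ip : i ≫ p = 𝟙 N) (pi : p ≫ i = coinvEnd h φ ρ) :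
    ∃ φN : N ⊗ b.obj ⟶ N, φN ≫ i = (i ⊗ₘ b.ι) ≫ φ := by
  refine ⟨(i ⊗ₘ b.ι) ≫ φ ≫ p, ?_⟩
  have h1 : (i ⊗ₘ b.ι) = N ◁ b.ι ≫ i ▷ B := MonoidalCategory.tensorHom_def' _ _
  have h2 : b.ι ≫ b.π ≫ b.ι = b.ι := by rw [← Category.assoc, b.ι_π, Category.id_comp]
  simp only [Category.assoc, pi, h1]
  rw [hM.coinv_act_coinvEnd hh ip pi, ← whisker_exchange_assoc, ← whiskerLeft_comp_assoc, h2,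
    whisker_exchange_assoc]

end Module

end HopfModules

/-! ### Coequalizers preserved by tensoring -/

section Coequalizers

variable {C : Type u} [Category.{v} C]

/-- `n` is a coequalizer of some pair of morphisms. -/
def IsCoequalizerMap {Y T : C} (n : Y ⟶ T) : Prop :=
  ∃ (Z : C) (f g : Z ⟶ Y) (w : f ≫ n = g ≫ n), Nonempty (IsColimit (Cofork.ofπ n w))

theorem IsCoequalizerMap.epi {Y T : C} {n : Y ⟶ T} (hn : IsCoequalizerMap n) : Epi n := by
  obtain ⟨_, _, _, _, ⟨hc⟩⟩ := hn
  exact ⟨fun _ _ h => Cofork.IsColimit.hom_ext hc h⟩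

theorem exists_desc_of_isColimit {Z Y T : C} {f g : Z ⟶ Y} {n : Y ⟶ T} {w : f ≫ n = g ≫ n}
    (hc : IsColimit (Cofork.ofπ n w)) {W : C} (k : Y ⟶ W) (hk : f ≫ k = g ≫ k) :
    ∃ l : T ⟶ W, n ≫ l = k :=
  ⟨Cofork.IsColimit.desc hc k hk, Cofork.IsColimit.π_desc' hc k hk⟩

variable [MonoidalCategory C]

theorem IsCoequalizerMap.whiskerRight {Y T : C} {n : Y ⟶ T} (hn : IsCoequalizerMap n) (X : C)
    [PreservesColimitsOfShape WalkingParallelPair (tensorRight X)] :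
    IsCoequalizerMap (n ▷ X) := by
  obtain ⟨Z, f, g, w, ⟨hc⟩⟩ := hn
  exact ⟨Z ⊗ X, f ▷ X, g ▷ X, _, ⟨isColimitCoforkMapOfIsColimit (tensorRight X) w hc⟩⟩

theorem exists_desc_whiskerRight {Z Y T : C} {f g : Z ⟶ Y} {n : Y ⟶ T} {w : f ≫ n = g ≫ n}
    (hc : IsColimit (Cofork.ofπ n w)) (X : C)
    [PreservesColimitsOfShape WalkingParallelPair (tensorRight X)] {W : C} (k : Y ⊗ X ⟶ W)
    (hk : f ▷ X ≫ k = g ▷ X ≫ k) : ∃ l : T ⊗ X ⟶ W, n ▷ X ≫ l = k :=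
  exists_desc_of_isColimit (isColimitCoforkMapOfIsColimit (tensorRight X) w hc) k hk

end Coequalizers

/-! ### The tensor product over the coinvariants and the deformed action -/

section CoinvTensor

variable {C : Type u} [Category.{v} C] [MonoidalCategory C] [BraidedCategory C]
variable {H B : C} [WeakHopfQuasigroup H] [UnitalMagmaObj B] [ComoduleMagma H B] {h : H ⟶ B}
variable {b : CoinvImage h}

/-- Strong Hopf modules are transported along isomorphisms of comodules. -/
theorem IsStrongHopfModule.transport {M M' : C} {φ : M ⊗ B ⟶ M} {ρ : M ⟶ M ⊗ H}
    (hM : IsStrongHopfModule b φ ρ) (e : M ≅ M') {ρ' : M' ⟶ M' ⊗ H}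
    (he : IsColinear ρ ρ' e.hom) : IsStrongHopfModule b (e.inv ▷ B ≫ φ ≫ e.hom) ρ' := by
  have hρ : ρ' = e.inv ≫ ρ ≫ e.hom ▷ H := by rw [he, Iso.inv_hom_id_assoc]
  have act : ∀ {X : C} (f : X ⟶ B), M' ◁ f ≫ e.inv ▷ B ≫ φ ≫ e.hom =
      e.inv ▷ X ≫ (M ◁ f ≫ φ) ≫ e.hom := fun f => by
    rw [whisker_exchange_assoc]; simp
  have act_act : ∀ f g : H ⟶ B, M' ◁ delta H ≫ (α_ M' H H).inv ≫
      ((M' ◁ f ≫ e.inv ▷ B ≫ φ ≫ e.hom) ⊗ₘ g) ≫ e.inv ▷ B ≫ φ ≫ e.hom = e.inv ▷ H ≫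
        (M ◁ delta H ≫ (α_ M H H).inv ≫ ((M ◁ f ≫ φ) ⊗ₘ g) ≫ φ) ≫ e.hom := fun f g => by
    calc _ = M' ◁ delta H ≫ (α_ M' H H).inv ≫ (M' ◁ f ≫ e.inv ▷ B ≫ φ ≫ e.hom) ▷ H ≫
        M' ◁ g ≫ e.inv ▷ B ≫ φ ≫ e.hom := by rw [MonoidalCategory.tensorHom_def]; simp
      _ = (M' ◁ delta H ≫ e.inv ▷ (H ⊗ H)) ≫ (α_ M H H).inv ≫ (M ◁ f ≫ φ) ▷ H ≫
        M ◁ g ≫ φ ≫ e.hom := by rw [act, act]; simp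
      _ = _ := by rw [whisker_exchange, MonoidalCategory.tensorHom_def]; simp
  refine ⟨⟨?_, ?_⟩, ?_, ?_, ?_, ?_, ?_⟩
  · rw [hρ, Category.assoc, Category.assoc, ← whisker_exchange, reassoc_of% hM.isRightComodule.counit]
    simp
  · rw [hρ]
    calc _ = e.inv ≫ (ρ ≫ ρ ▷ H) ≫ e.hom ▷ H ▷ H := by simp
      _ = e.inv ≫ ρ ≫ (M ◁ delta H ≫ e.hom ▷ (H ⊗ H)) ≫ (α_ _ _ _).inv := by
        rw [hM.isRightComodule.coassoc]; simp
      _ = _ := by rw [whisker_exchange]; simp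
  · rw [act, hM.act_one]; simp
  · rw [act]
    calc _ = e.inv ▷ b.obj ▷ B ≫ ((M ◁ b.ι ≫ φ) ▷ B ≫ φ) ≫ e.hom := by
          simp
      _ = _ := by rw [hM.act_act, act]; simp
  · have hρ' : e.hom ≫ ρ' = ρ ≫ e.hom ▷ H := he.symm
    rw [tensorHom_tensorμ_mul]
    calc _ = e.inv ▷ B ≫ (φ ≫ ρ) ≫ e.hom ▷ H := by simp [hρ']
      _ = e.inv ▷ B ≫ ρ ▷ B ≫ ((M ⊗ H) ◁ rho H B ≫ (e.hom ▷ H ≫ e.inv ▷ H) ▷ (B ⊗ H)) ≫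
          (α_ (M ⊗ H) B H).inv ≫ passenger H φ ▷ H ≫ mulLast H M ≫ e.hom ▷ H := by
        rw [hM.act_coact_eq]; simp
      _ = ρ' ▷ B ≫ (e.inv ▷ H ▷ B ≫ (M ⊗ H) ◁ rho H B) ≫
          (α_ (M ⊗ H) B H).inv ≫ passenger H φ ▷ H ≫ mulLast H M ≫ e.hom ▷ H := by
        rw [whisker_exchange, hρ]; simp
      _ = _ := by
        rw [← whisker_exchange, ← whiskerRight_mulLast, ← whiskerRight_passenger, passenger_comp]
        simp
  · rw [act_act, hM.act_act_antipode, act]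
  · rw [act_act, hM.act_antipode_act, act]

variable {M : C} {φ : M ⊗ B ⟶ M} {ρ : M ⟶ M ⊗ H}

section

variable [HasCoequalizers C] [PreservesColimitsOfShape WalkingParallelPair (tensorRight B)]

/-- The action, the coaction and `ω` descend to the coequalizer by `LeftAssoc`, by `ι_mul_rho` and
by (d2-2) respectively; the inverse of `ω` is `m ↦ p(m₀) ⊗ h(m₁)`. -/
theorem IsStrongHopfModule.exists_coinvTensor [IsIdempotentComplete C]
    (hM : IsStrongHopfModule b φ ρ) (hh : IsAnchor h) (hb : LeftAssoc b) :
    ∃ d : CoinvTensor b M, d.IsFor φ ρ := by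
  obtain ⟨N, i, p, ip, pi⟩ := IsIdempotentComplete.idempotents_split M (coinvEnd h φ ρ) (by
    rw [coinvEnd_eq]; exact (hM.isStrongHopfAction hh).coinvProj_idem)
  obtain ⟨φN, hφN⟩ := hM.exists_coinv_act hh ip pi
  let f : (N ⊗ b.obj) ⊗ B ⟶ N ⊗ B := φN ▷ B
  let g : (N ⊗ b.obj) ⊗ B ⟶ N ⊗ B := (α_ N b.obj B).hom ≫ N ◁ (b.ι ▷ B ≫ mu B)
  obtain ⟨T, n, w, ⟨hc⟩⟩ : ∃ (T : C) (n : N ⊗ B ⟶ T) (w : f ≫ n = g ≫ n),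
      Nonempty (IsColimit (Cofork.ofπ n w)) :=
    ⟨coequalizer f g, coequalizer.π f g, coequalizer.condition f g,
      ⟨coequalizerIsCoequalizer f g⟩⟩
  have hn : Epi n := IsCoequalizerMap.epi ⟨_, _, _, _, ⟨hc⟩⟩
  have hw : φN ▷ B ≫ n = (α_ N b.obj B).hom ≫ N ◁ (b.ι ▷ B ≫ mu B) ≫ n := by
    simpa [f, g] using w
  have hb' : (b.ι ▷ B ≫ mu B) ▷ B ≫ mu B =
      (α_ b.obj B B).hom ≫ b.obj ◁ mu B ≫ b.ι ▷ B ≫ mu B := by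
    rw [← hb, MonoidalCategory.tensorHom_def', Category.assoc]
  obtain ⟨actT, hactT⟩ := exists_desc_whiskerRight hc B ((α_ N B B).hom ≫ N ◁ mu B ≫ n) (by
    calc _ = 𝟙 _ ⊗≫ (φN ▷ (B ⊗ B) ≫ N ◁ mu B) ⊗≫ n := by simp only [f]; monoidal
      _ = 𝟙 _ ⊗≫ (N ⊗ b.obj) ◁ mu B ⊗≫ (φN ▷ B ≫ n) := by rw [← whisker_exchange]; monoidal
      _ = 𝟙 _ ⊗≫ N ◁ ((α_ b.obj B B).hom ≫ b.obj ◁ mu B ≫ b.ι ▷ B ≫ mu B) ⊗≫ n := by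
        rw [hw]; monoidal
      _ = _ := by rw [← hb']; simp only [g]; monoidal)
  obtain ⟨coactT, hcoactT⟩ := exists_desc_of_isColimit hc
    (N ◁ rho H B ≫ (α_ N B H).inv ≫ n ▷ H) (by
    calc _ = 𝟙 _ ⊗≫ (φN ▷ B ≫ N ◁ rho H B) ⊗≫ n ▷ H := by simp only [f]; monoidal
      _ = 𝟙 _ ⊗≫ (N ⊗ b.obj) ◁ rho H B ⊗≫ (φN ▷ B ≫ n) ▷ H := by
        rw [← whisker_exchange]; monoidal
      _ = 𝟙 _ ⊗≫ N ◁ (b.obj ◁ rho H B ≫ b.ι ▷ (B ⊗ H)) ⊗≫ N ◁ mu B ▷ H ⊗≫ n ▷ H := by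
        rw [hw]; monoidal
      _ = 𝟙 _ ⊗≫ N ◁ (b.ι ▷ B ≫ B ◁ rho H B ≫ (α_ B B H).inv ≫ mu B ▷ H) ⊗≫ n ▷ H := by
        rw [whisker_exchange]; monoidal
      _ = _ := by rw [← hh.ι_mul_rho]; simp only [g]; monoidal)
  obtain ⟨ω, hω⟩ := exists_desc_of_isColimit hc (i ▷ B ≫ φ) (by
    calc _ = (φN ≫ i) ▷ B ≫ φ := by simp [f]
      _ = 𝟙 _ ⊗≫ i ▷ b.obj ▷ B ⊗≫ ((M ◁ b.ι ≫ φ) ▷ B ≫ φ) := by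
        rw [hφN, MonoidalCategory.tensorHom_def]; monoidal
      _ = 𝟙 _ ⊗≫ (i ▷ (b.obj ⊗ B) ≫ M ◁ (b.ι ▷ B ≫ mu B)) ⊗≫ φ := by
        rw [hM.act_act]; monoidal
      _ = _ := by rw [← whisker_exchange]; simp only [g]; monoidal)
  have h1 : (ρ ≫ p ▷ H ≫ N ◁ h ≫ n) ≫ ω = 𝟙 M := by
    calc _ = ρ ≫ p ▷ H ≫ (N ◁ h ≫ i ▷ B) ≫ φ := by simp [hω]
      _ = ρ ≫ (p ≫ i) ▷ H ≫ M ◁ h ≫ φ := by rw [whisker_exchange]; simp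
      _ = _ := by rw [pi, coinvEnd_eq]; exact (hM.isStrongHopfAction hh).coinvProj_act
  -- On `n ⊗ b` the composite is `p(n · b₀) ⊗ h(b₁)`, where `p(n · b₀)` is `p_B(b₀)` acting on `n`.
  -- The coequalizer moves that factor across the tensor sign, and `q_B(b₀) h(b₁) = b`.
  have h2 : ω ≫ ρ ≫ p ▷ H ≫ N ◁ h ≫ n = 𝟙 T := by
    rw [← cancel_epi n]
    calc _ = ((i ▷ B ≫ φ) ≫ ρ) ≫ p ▷ H ≫ N ◁ h ≫ n := by rw [← hω]; simp
      _ = (i ▷ B ≫ M ◁ rho H B) ≫ (α_ M B H).inv ≫ (φ ≫ p) ▷ H ≫ N ◁ h ≫ n := by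
        rw [hM.coinv_act_coact hh ip pi]; simp
      _ = N ◁ rho H B ≫ (α_ N B H).inv ≫ (i ▷ B ≫ φ ≫ p) ▷ H ≫ N ◁ h ≫ n := by
        rw [← whisker_exchange]; simp
      _ = N ◁ rho H B ≫ (α_ N B H).inv ≫ (N ◁ b.π) ▷ H ≫ (φN ▷ H ≫ N ◁ h) ≫ n := by
        rw [hM.coinv_act_proj hh ip pi hφN]; simp
      _ = N ◁ rho H B ≫ (α_ N B H).inv ≫ (N ◁ b.π) ▷ H ≫ (N ⊗ b.obj) ◁ h ≫ φN ▷ B ≫ n := by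
        rw [← whisker_exchange]; simp
      _ = 𝟙 _ ⊗≫ N ◁ (rho H B ≫ b.π ▷ H ≫ (b.obj ◁ h ≫ b.ι ▷ B) ≫ mu B) ⊗≫ n := by
        rw [hw]; monoidal
      _ = 𝟙 _ ⊗≫ N ◁ (rho H B ≫ (b.π ≫ b.ι) ▷ H ≫ B ◁ h ≫ mu B) ⊗≫ n := by
        rw [whisker_exchange]; monoidal
      _ = _ := by rw [hh.coinvEnd_mul]; monoidal
  exact ⟨⟨N, i, p, φN, T, n, actT, coactT, ⟨ω, _, h2, h1⟩⟩,
    ⟨ip, pi, hφN, ⟨w, ⟨hc⟩⟩, hactT, hcoactT, hω⟩⟩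

end

namespace CoinvTensor.IsFor

variable {d : CoinvTensor b M}

theorem isCoequalizerMap (hd : d.IsFor φ ρ) : IsCoequalizerMap d.n := by
  obtain ⟨w, hc⟩ := hd.isCoequalizer
  exact ⟨_, _, _, w, hc⟩

theorem ω_inv (hd : d.IsFor φ ρ) (hM : IsStrongHopfModule b φ ρ) (hh : IsAnchor h) :
    d.ω.inv = ρ ≫ d.p ▷ H ≫ d.N ◁ h ≫ d.n := by
  rw [← cancel_mono d.ω.hom, Iso.inv_hom_id]
  symm
  calc _ = ρ ≫ d.p ▷ H ≫ (d.N ◁ h ≫ d.i ▷ B) ≫ φ := by simp [hd.n_ω]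
    _ = ρ ≫ (d.p ≫ d.i) ▷ H ≫ M ◁ h ≫ φ := by rw [whisker_exchange]; simp
    _ = _ := by rw [hd.p_i, coinvEnd_eq]; exact (hM.isStrongHopfAction hh).coinvProj_act

theorem colinear (hd : d.IsFor φ ρ) (hM : IsStrongHopfModule b φ ρ) (hh : IsAnchor h) :
    IsColinear d.coactT ρ d.ω.hom := by
  have := hd.isCoequalizerMap.epi
  rw [IsColinear, ← cancel_epi d.n]
  calc _ = d.N ◁ rho H B ≫ (α_ d.N B H).inv ≫ (d.i ▷ B ≫ φ) ▷ H := by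
        rw [reassoc_of% hd.n_coactT, ← hd.n_ω]; simp
    _ = (d.N ◁ rho H B ≫ d.i ▷ (B ⊗ H)) ≫ (α_ M B H).inv ≫ φ ▷ H := by simp
    _ = (d.i ▷ B ≫ φ) ≫ ρ := by
        rw [hM.coinv_act_coact hh hd.i_p hd.p_i, whisker_exchange, Category.assoc]
    _ = _ := by rw [← hd.n_ω, Category.assoc]

/-- `φ^ω(m ⊗ b) = q(m₀) · (h(m₁) b)`. -/
theorem deformedAct_eq (hd : d.IsFor φ ρ) (hM : IsStrongHopfModule b φ ρ) (hh : IsAnchor h) :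
    d.deformedAct = ρ ▷ B ≫ (α_ M H B).hom ≫ (coinvEnd h φ ρ ⊗ₘ (h ▷ B ≫ mu B)) ≫ φ := by
  calc _ = ρ ▷ B ⊗≫ d.p ▷ H ▷ B ⊗≫ d.N ◁ h ▷ B ⊗≫ (d.n ▷ B ≫ d.actT) ≫ d.ω.hom := by
        rw [deformedAct, hd.ω_inv hM hh]; monoidal
    _ = ρ ▷ B ⊗≫ d.p ▷ H ▷ B ⊗≫ d.N ◁ (h ▷ B ≫ mu B) ≫ d.n ≫ d.ω.hom := by
        rw [hd.n_actT]; monoidal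
    _ = ρ ▷ B ⊗≫ d.p ▷ (H ⊗ B) ⊗≫ (d.N ◁ (h ▷ B ≫ mu B) ≫ d.i ▷ B) ≫ φ := by
        rw [hd.n_ω]; monoidal
    _ = ρ ▷ B ⊗≫ (d.p ≫ d.i) ▷ (H ⊗ B) ⊗≫ M ◁ (h ▷ B ≫ mu B) ≫ φ := by
        rw [whisker_exchange]; monoidal
    _ = _ := by rw [hd.p_i, MonoidalCategory.tensorHom_def]; monoidal

/-- `φ^ω` agrees with `φ` on coinvariants. -/
theorem coinv_deformedAct (hd : d.IsFor φ ρ) (hM : IsStrongHopfModule b φ ρ) :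
    d.i ▷ B ≫ d.deformedAct = d.i ▷ B ≫ φ := by
  -- On a coinvariant, `ω⁻¹(n) = n ⊗ 1`, so `φ^ω(n ⊗ b) = ω(n ⊗ b) = n · b`.
  have h1 : d.i ≫ d.ω.inv = (ρ_ d.N).inv ≫ d.N ◁ eta B ≫ d.n := by
    rw [← cancel_mono d.ω.hom]
    simp only [Category.assoc, Iso.inv_hom_id, Category.comp_id, hd.n_ω]
    rw [whisker_exchange_assoc, hM.act_one]; simp
  calc _ = (d.i ≫ d.ω.inv) ▷ B ≫ d.actT ≫ d.ω.hom := by simp [deformedAct]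
    _ = ((ρ_ d.N).inv ≫ d.N ◁ eta B) ▷ B ≫ (d.n ▷ B ≫ d.actT) ≫ d.ω.hom := by rw [h1]; simp
    _ = 𝟙 _ ⊗≫ d.N ◁ (eta B ▷ B ≫ mu B) ≫ d.n ≫ d.ω.hom := by rw [hd.n_actT]; monoidal
    _ = _ := by rw [UnitalMagmaObj.one_mul, hd.n_ω]; monoidal

/-- Multiplicativity of `h` collapses `q(m₀) · (h(m₁) h(λ(m₂)))` to `q(m₀) · h(Πᴸ(m₁))`, which is
`q(m)`. -/
theorem coinvEnd_deformedAct (hd : d.IsFor φ ρ) (hM : IsStrongHopfModule b φ ρ)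
    (hh : IsAnchor h) : coinvEnd h d.deformedAct ρ = coinvEnd h φ ρ := by
  have h2 : M ◁ delta H ≫ (α_ M H H).inv ≫ (M ◁ h ≫ φ) ▷ H ≫ M ◁ lam H ≫ M ◁ h ≫ φ =
    M ◁ PiL H ≫ M ◁ h ≫ φ := (hM.isStrongHopfAction hh).act_act_antipode
  have h3 : delta H ≫ H ◁ lam H ≫ mu H = PiL H := by
    simp [PiL, conv, MonoidalCategory.tensorHom_def]
  have h4 : ρ ≫ coinvEnd h φ ρ ▷ H ≫ M ◁ PiL H ≫ M ◁ h ≫ φ = coinvEnd h φ ρ := by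
    rw [coinvEnd_eq]; exact (hM.isStrongHopfAction hh).coinvProj_act_PiL
  calc _ = ρ ≫ (M ◁ (lam H ≫ h) ≫ ρ ▷ B) ≫ (α_ M H B).hom ≫ coinvEnd h φ ρ ▷ (H ⊗ B) ≫
      M ◁ (h ▷ B ≫ mu B) ≫ φ := by
        conv_lhs => rw [coinvEnd, hd.deformedAct_eq hM hh, MonoidalCategory.tensorHom_def]
        simp
    _ = (ρ ≫ ρ ▷ H) ⊗≫ M ◁ H ◁ (lam H ≫ h) ⊗≫ coinvEnd h φ ρ ▷ (H ⊗ B) ⊗≫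
      M ◁ (h ▷ B ≫ mu B) ≫ φ := by rw [whisker_exchange]; monoidal
    _ = ρ ⊗≫ (M ◁ (delta H ≫ H ◁ (lam H ≫ h)) ≫ coinvEnd h φ ρ ▷ (H ⊗ B)) ⊗≫
      M ◁ (h ▷ B ≫ mu B) ≫ φ := by rw [hM.isRightComodule.coassoc]; monoidal
    _ = ρ ⊗≫ coinvEnd h φ ρ ▷ H ⊗≫ M ◁ (delta H ≫ H ◁ lam H ≫ (H ◁ h ≫ h ▷ B) ≫ mu B) ≫ φ := by
      rw [whisker_exchange]; monoidal
    _ = ρ ⊗≫ coinvEnd h φ ρ ▷ H ⊗≫ M ◁ (delta H ≫ H ◁ lam H ≫ (h ⊗ₘ h) ≫ mu B) ≫ φ := by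
      rw [← MonoidalCategory.tensorHom_def']
    _ = ρ ≫ coinvEnd h φ ρ ▷ H ≫ M ◁ (delta H ≫ H ◁ lam H ≫ mu H) ≫ M ◁ h ≫ φ := by
      rw [hh.map_mul]; monoidal
    _ = _ := by rw [h3, h4]

/-- The conditions on the data involve `φ` only through `q_M` and through its restriction to
`M^{coH} ⊗ B`, and the deformation preserves both. -/
theorem isFor_deformedAct (hd : d.IsFor φ ρ) (hM : IsStrongHopfModule b φ ρ)
    (hh : IsAnchor h) : d.IsFor d.deformedAct ρ where
  i_p := hd.i_p
  p_i := by rw [hd.p_i, hd.coinvEnd_deformedAct hM hh]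
  actN_i := by
    rw [hd.actN_i, MonoidalCategory.tensorHom_def', Category.assoc, Category.assoc,
      hd.coinv_deformedAct hM]
  isCoequalizer := hd.isCoequalizer
  n_actT := hd.n_actT
  n_coactT := hd.n_coactT
  n_ω := by rw [hd.n_ω, hd.coinv_deformedAct hM]

/-- The formula for the deformed action mentions neither `T` nor `ω`, so the second choice of data
may be arbitrary. -/
theorem deformedAct_deformedAct (hd : d.IsFor φ ρ) (hM : IsStrongHopfModule b φ ρ)
    (hh : IsAnchor h) (hM' : IsStrongHopfModule b d.deformedAct ρ) {d' : CoinvTensor b M}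
    (hd' : d'.IsFor d.deformedAct ρ) : d'.deformedAct = d.deformedAct := by
  rw [hd'.deformedAct_eq hM' hh, hd.coinvEnd_deformedAct hM hh, MonoidalCategory.tensorHom_def',
    ← hd.p_i, comp_whiskerRight, Category.assoc, Category.assoc, hd.coinv_deformedAct hM,
    hd.deformedAct_eq hM hh, MonoidalCategory.tensorHom_def', ← hd.p_i]
  simp

section

variable [PreservesColimitsOfShape WalkingParallelPair (tensorRight B)]

/-- Precomposed with the epimorphism `n`, suitably tensored, each axiom becomes `M^{coH}` tensored
with the corresponding identity in `B`: `MiddleAssoc` for (d2-2), (c1) and (c2) for the last two. -/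
theorem isStrongHopfModule_tensor [PreservesColimitsOfShape WalkingParallelPair (tensorRight H)]
    (hd : d.IsFor φ ρ) (hh : IsAnchor h) (hb : MiddleAssoc b) :
    IsStrongHopfModule b d.actT d.coactT := by
  have en := hd.isCoequalizerMap.epi
  have enB := (hd.isCoequalizerMap.whiskerRight B).epi
  have enH := (hd.isCoequalizerMap.whiskerRight H).epi
  have enBB := ((hd.isCoequalizerMap.whiskerRight B).whiskerRight B).epi
  have hρ : IsRightComodule (rho H B) := ComoduleMagma.isRightComodule
  have act : ∀ {X : C} (f : X ⟶ B), d.n ▷ X ≫ d.T ◁ f ≫ d.actT =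
      (α_ d.N B X).hom ≫ d.N ◁ (B ◁ f ≫ mu B) ≫ d.n := fun f => by
    rw [← whisker_exchange_assoc, hd.n_actT]; simp
  have act_act : ∀ f g : H ⟶ B, d.n ▷ H ≫ d.T ◁ delta H ≫ (α_ d.T H H).inv ≫
      ((d.T ◁ f ≫ d.actT) ⊗ₘ g) ≫ d.actT = (α_ d.N B H).hom ≫
        d.N ◁ (B ◁ delta H ≫ (α_ B H H).inv ≫ ((B ◁ f ≫ mu B) ⊗ₘ g) ≫ mu B) ≫ d.n :=
    fun f g => by
    calc _ = (d.n ▷ H ≫ d.T ◁ delta H) ≫ (α_ d.T H H).inv ≫ (d.T ◁ f ≫ d.actT) ▷ H ≫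
        d.T ◁ g ≫ d.actT := by rw [MonoidalCategory.tensorHom_def]; simp
      _ = (d.N ⊗ B) ◁ delta H ⊗≫ (d.n ▷ H ≫ d.T ◁ f ≫ d.actT) ▷ H ≫ d.T ◁ g ≫ d.actT := by
        rw [← whisker_exchange]; monoidal
      _ = (d.N ⊗ B) ◁ delta H ⊗≫ d.N ◁ (B ◁ f ≫ mu B) ▷ H ⊗≫ (d.n ▷ H ≫ d.T ◁ g ≫ d.actT) := by
        rw [act]; monoidal
      _ = _ := by rw [act, MonoidalCategory.tensorHom_def]; monoidal
  refine ⟨⟨?_, ?_⟩, ?_, ?_, ?_, ?_, ?_⟩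
  · rw [← cancel_epi d.n, reassoc_of% hd.n_coactT, ← whisker_exchange]
    calc _ = 𝟙 _ ⊗≫ d.N ◁ (rho H B ≫ B ◁ eps H) ⊗≫ d.n ▷ 𝟙_ C := by monoidal
      _ = _ := by rw [hρ.counit]; monoidal
  · rw [← cancel_epi d.n, reassoc_of% hd.n_coactT, reassoc_of% hd.n_coactT,
      ← comp_whiskerRight, hd.n_coactT, ← whisker_exchange_assoc]
    calc _ = 𝟙 _ ⊗≫ d.N ◁ (rho H B ≫ rho H B ▷ H) ⊗≫ d.n ▷ H ▷ H := by monoidal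
      _ = _ := by rw [hρ.coassoc]; monoidal
  · have h1 : (ρ_ d.T).inv ≫ d.T ◁ eta B ≫ d.actT = 𝟙 d.T := by
      rw [← cancel_epi d.n, rightUnitor_inv_naturality_assoc, act, UnitalMagmaObj.mul_one]
      monoidal
    rw [← cancel_epi (ρ_ d.T).inv, h1, Iso.inv_hom_id]
  · have h1 : (B ◁ (b.π ≫ b.ι) ≫ mu B) ▷ B ≫ mu B =
        (α_ B B B).hom ≫ B ◁ ((b.π ≫ b.ι) ▷ B ≫ mu B) ≫ mu B := by
      calc _ = (B ◁ b.π) ▷ B ≫ (B ◁ b.ι ≫ mu B) ▷ B ≫ mu B := by monoidal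
        _ = _ := by rw [hb]; monoidal
    -- Only `- ⊗ B` and `- ⊗ H` are assumed to preserve coequalizers, so `n` is cancelled on `T ⊗ B
    -- ⊗ B` with `q_B` in place of `i_B`. Precomposing with `i_B` then recovers (d2-2).
    have h2 : (d.T ◁ (b.π ≫ b.ι) ≫ d.actT) ▷ B ≫ d.actT =
        (α_ d.T B B).hom ≫ d.T ◁ ((b.π ≫ b.ι) ▷ B ≫ mu B) ≫ d.actT := by
      rw [← cancel_epi (d.n ▷ B ▷ B)]
      calc _ = (d.n ▷ B ≫ d.T ◁ (b.π ≫ b.ι) ≫ d.actT) ▷ B ≫ d.actT := by simp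
        _ = 𝟙 _ ⊗≫ d.N ◁ (B ◁ (b.π ≫ b.ι) ≫ mu B) ▷ B ⊗≫ (d.n ▷ B ≫ d.actT) := by
          rw [act]; monoidal
        _ = 𝟙 _ ⊗≫ d.N ◁ ((B ◁ (b.π ≫ b.ι) ≫ mu B) ▷ B ≫ mu B) ⊗≫ d.n := by
          rw [hd.n_actT]; monoidal
        _ = (α_ _ B B).hom ≫ (α_ d.N B (B ⊗ B)).hom ≫
            d.N ◁ (B ◁ ((b.π ≫ b.ι) ▷ B ≫ mu B) ≫ mu B) ≫ d.n := by rw [h1]; monoidal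
        _ = _ := by rw [← act]; simp
    have h3 : b.ι ≫ b.π ≫ b.ι = b.ι := by rw [← Category.assoc, b.ι_π, Category.id_comp]
    calc _ = (d.T ◁ (b.ι ≫ b.π ≫ b.ι) ≫ d.actT) ▷ B ≫ d.actT := by rw [h3]
      _ = (d.T ◁ b.ι) ▷ B ≫ (d.T ◁ (b.π ≫ b.ι) ≫ d.actT) ▷ B ≫ d.actT := by monoidal
      _ = (α_ d.T b.obj B).hom ≫ d.T ◁ ((b.ι ≫ b.π ≫ b.ι) ▷ B ≫ mu B) ≫ d.actT := by
        rw [h2]; monoidal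
      _ = _ := by rw [h3]
  · rw [tensorHom_tensorμ_mul, ← cancel_epi (d.n ▷ B)]
    calc _ = (α_ d.N B B).hom ≫ d.N ◁ mu B ≫ d.n ≫ d.coactT := by
          rw [reassoc_of% hd.n_actT]
      _ = 𝟙 _ ⊗≫ d.N ◁ (mu B ≫ rho H B) ⊗≫ d.n ▷ H := by rw [hd.n_coactT]; monoidal
      _ = 𝟙 _ ⊗≫ d.N ◁ (rho H B ▷ B ≫ (B ⊗ H) ◁ rho H B) ⊗≫ d.N ◁ passenger H (mu B) ▷ H ⊗≫
          (d.N ◁ B ◁ mu H ⊗≫ d.n ▷ H) := by rw [mul_rho]; simp only [mulLast]; monoidal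
      _ = 𝟙 _ ⊗≫ d.N ◁ (rho H B ▷ B ≫ (B ⊗ H) ◁ rho H B) ⊗≫ d.N ◁ passenger H (mu B) ▷ H ⊗≫
          ((d.N ⊗ B) ◁ mu H ≫ d.n ▷ H) := by monoidal
      _ = 𝟙 _ ⊗≫ d.N ◁ (rho H B ▷ B ≫ (B ⊗ H) ◁ rho H B) ⊗≫ passenger H ((α_ d.N B B).hom ≫
          d.N ◁ mu B ≫ d.n) ▷ H ⊗≫ d.T ◁ mu H := by
        rw [whisker_exchange, ← Category.assoc (α_ d.N B B).hom, passenger_comp,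
          passenger_whiskerLeft]
        monoidal
      _ = 𝟙 _ ⊗≫ d.N ◁ (rho H B ▷ B) ⊗≫ (((d.N ⊗ B) ⊗ H) ◁ rho H B ≫ d.n ▷ H ▷ (B ⊗ H)) ⊗≫
          passenger H d.actT ▷ H ⊗≫ d.T ◁ mu H := by
        rw [← hd.n_actT, ← whiskerRight_passenger]; monoidal
      _ = (d.N ◁ rho H B ≫ (α_ d.N B H).inv ≫ d.n ▷ H) ▷ B ⊗≫ (d.T ⊗ H) ◁ rho H B ⊗≫
          passenger H d.actT ▷ H ⊗≫ d.T ◁ mu H := by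
        rw [whisker_exchange]; monoidal
      _ = _ := by rw [← hd.n_coactT]; simp only [mulLast]; monoidal
  · rw [← cancel_epi (d.n ▷ H), act_act, act, hh.mul_mul_antipode]
  · rw [← cancel_epi (d.n ▷ H), act_act, act, hh.mul_antipode_mul]

/-- Here `q_T(n ⊗ b) = n ⊗ q_B(b)`, so the formula for the deformed action yields `n ⊗ q_B(b₀)(h(b₁)
b')`. `LeftAssoc` rebrackets this to `n ⊗ (q_B(b₀) h(b₁)) b' = n ⊗ b b'`. -/
theorem deformedAct_tensor (hd : d.IsFor φ ρ) (hh : IsAnchor h) (hb : LeftAssoc b)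
    (hT : IsStrongHopfModule b d.actT d.coactT) {d' : CoinvTensor b d.T}
    (hd' : d'.IsFor d.actT d.coactT) : d'.deformedAct = d.actT := by
  have enB := (hd.isCoequalizerMap.whiskerRight B).epi
  have hb' : (b.ι ▷ B ≫ mu B) ▷ B ≫ mu B =
      (α_ b.obj B B).hom ≫ b.obj ◁ mu B ≫ b.ι ▷ B ≫ mu B := by
    rw [← hb, MonoidalCategory.tensorHom_def', Category.assoc]
  have h1 : d.n ≫ coinvEnd h d.actT d.coactT = d.N ◁ (b.π ≫ b.ι) ≫ d.n := by
    rw [b.π_ι]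
    simp only [coinvEnd]
    rw [reassoc_of% hd.n_coactT, ← whisker_exchange_assoc, hd.n_actT]
    monoidal
  have h2 : rho H B ▷ B ≫ (α_ B H B).hom ≫ B ◁ (h ▷ B ≫ mu B) ≫ (b.π ≫ b.ι) ▷ B ≫ mu B =
      mu B := by
    calc _ = rho H B ▷ B ⊗≫ B ◁ h ▷ B ⊗≫ (B ◁ mu B ≫ b.π ▷ B) ⊗≫ b.ι ▷ B ≫ mu B := by monoidal
      _ = rho H B ▷ B ⊗≫ (B ◁ h ≫ b.π ▷ B) ▷ B ⊗≫ ((α_ b.obj B B).hom ≫ b.obj ◁ mu B ≫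
          b.ι ▷ B ≫ mu B) := by rw [whisker_exchange]; monoidal
      _ = rho H B ▷ B ⊗≫ (B ◁ h ≫ (b.π ≫ b.ι) ▷ B) ▷ B ⊗≫ mu B ▷ B ≫ mu B := by
        rw [← hb']; monoidal
      _ = (rho H B ≫ (b.π ≫ b.ι) ▷ H ≫ B ◁ h ≫ mu B) ▷ B ≫ mu B := by
        rw [whisker_exchange]; monoidal
      _ = _ := by rw [hh.coinvEnd_mul]; simp
  rw [← cancel_epi (d.n ▷ B), hd'.deformedAct_eq hT hh, MonoidalCategory.tensorHom_def']
  calc _ = (d.n ≫ d.coactT) ▷ B ≫ (α_ d.T H B).hom ≫ d.T ◁ (h ▷ B ≫ mu B) ≫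
      coinvEnd h d.actT d.coactT ▷ B ≫ d.actT := by simp
    _ = (d.N ◁ rho H B) ▷ B ⊗≫ (d.n ▷ (H ⊗ B) ≫ d.T ◁ (h ▷ B ≫ mu B)) ⊗≫
      coinvEnd h d.actT d.coactT ▷ B ≫ d.actT := by rw [hd.n_coactT]; monoidal
    _ = (d.N ◁ rho H B) ▷ B ⊗≫ (d.N ⊗ B) ◁ (h ▷ B ≫ mu B) ⊗≫
      (d.n ≫ coinvEnd h d.actT d.coactT) ▷ B ≫ d.actT := by rw [← whisker_exchange]; monoidal
    _ = (d.N ◁ rho H B) ▷ B ⊗≫ (d.N ⊗ B) ◁ (h ▷ B ≫ mu B) ⊗≫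
      (d.N ◁ (b.π ≫ b.ι)) ▷ B ⊗≫ (d.n ▷ B ≫ d.actT) := by rw [h1]; monoidal
    _ = 𝟙 _ ⊗≫ d.N ◁ (rho H B ▷ B ≫ (α_ B H B).hom ≫ B ◁ (h ▷ B ≫ mu B) ≫
      (b.π ≫ b.ι) ▷ B ≫ mu B) ⊗≫ d.n := by rw [hd.n_actT]; monoidal
    _ = _ := by rw [h2, hd.n_actT]; monoidal

theorem isStrongHopfModule_deformedAct
    [PreservesColimitsOfShape WalkingParallelPair (tensorRight H)] (hd : d.IsFor φ ρ)
    (hM : IsStrongHopfModule b φ ρ) (hh : IsAnchor h) (hb : MiddleAssoc b) :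
    IsStrongHopfModule b d.deformedAct ρ :=
  (hd.isStrongHopfModule_tensor hh hb).transport d.ω (hd.colinear hM hh)

end

end CoinvTensor.IsFor

/-- The functors `D ∘ D` and `D` agree on objects by a proved equality of actions, so their values
on morphisms have to be compared heterogeneously. -/
theorem SM.hom_heq {𝒟 : CoinvTensorChoice b} {P P' Q Q' : SM 𝒟} (hP : P = P') (hQ : Q = Q')
    {f : P ⟶ Q} {f' : P' ⟶ Q'} (w : HEq f.hom f'.hom) : HEq f f' := by
  subst hP hQ
  exact heq_of_eq (SM.Hom.ext (eq_of_heq w))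

end CoinvTensor

end DoiHopf

/-! ### The main theorem -/

theorem proposition2p16 {C : Type u} [Category.{v} C] [MonoidalCategory C] [BraidedCategory C]
    [IsIdempotentComplete C] [HasCoequalizers C]
    (H B : C) [DoiHopf.WeakHopfQuasigroup H] [DoiHopf.UnitalMagmaObj B]
    [DoiHopf.ComoduleMagma H B]
    [PreservesColimitsOfShape WalkingParallelPair (tensorRight B)]
    [PreservesColimitsOfShape WalkingParallelPair (tensorRight H)]
    (h : H ⟶ B) (hh : DoiHopf.IsAnchor h) :
    -- the object of coinvariants of `B` exists
    Nonempty (DoiHopf.CoinvImage h) ∧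
    ∀ b : DoiHopf.CoinvImage h, DoiHopf.MiddleAssoc b → DoiHopf.LeftAssoc b →
      -- every strong Hopf module `M` has `M^{coH}`, `M^{coH} ⊗_{B^{coH}} B` and `ω_M`
      (∀ M : DoiHopf.StrongHopfModule b, ∃ d : DoiHopf.CoinvTensor b M.X,
        d.IsFor M.act M.coact) ∧
      (∀ (M : DoiHopf.StrongHopfModule b) (d : DoiHopf.CoinvTensor b M.X),
        d.IsFor M.act M.coact →
        -- `M^{coH} ⊗_{B^{coH}} B` is a strong Hopf module and `ω_M` is colinear
        DoiHopf.IsStrongHopfModule b d.actT d.coactT ∧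
        DoiHopf.IsColinear d.coactT M.coact d.ω.hom ∧
        -- `(M, φ_M^{ω_M}, ρ_M)` is a strong Hopf module
        DoiHopf.IsStrongHopfModule b d.deformedAct M.coact ∧
        -- the formula for the deformed action
        d.deformedAct =
          M.coact ▷ B ≫ (α_ M.X H B).hom ≫
            (DoiHopf.coinvEnd h M.act M.coact ⊗ₘ (h ▷ B ≫ DoiHopf.mu B)) ≫ M.act ∧
        -- `q_M^{ω_M} = q_M`
        DoiHopf.coinvEnd h d.deformedAct M.coact = DoiHopf.coinvEnd h M.act M.coact ∧
        -- `(M, φ_M^{ω_M}, ρ_M)` has the same coinvariants and the same isomorphism `ω_M`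
        d.IsFor d.deformedAct M.coact ∧
        -- `(φ_M^{ω_M})^{ω_M} = φ_M^{ω_M}`
        (∀ d' : DoiHopf.CoinvTensor b M.X, d'.IsFor d.deformedAct M.coact →
          d'.deformedAct = d.deformedAct) ∧
        -- the action of `M^{coH} ⊗_{B^{coH}} B` is its own deformation
        (∀ d' : DoiHopf.CoinvTensor b d.T, d'.IsFor d.actT d.coactT →
          d'.deformedAct = d.actT)) ∧
      -- the deformation functor is well defined, is idempotent, and fixes
      -- the modules `M^{coH} ⊗_{B^{coH}} B`
      (∀ 𝒟 : DoiHopf.CoinvTensorChoice b,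
        ∃ (hobj : ∀ M : DoiHopf.SM 𝒟, DoiHopf.IsStrongHopfModule b M.defAct M.mod.coact)
          (hmap : ∀ (M N : DoiHopf.SM 𝒟) (f : M ⟶ N),
            DoiHopf.SM.IsMorphism (𝒟 := 𝒟) ⟨⟨M.mod.X, M.defAct, M.mod.coact, hobj M⟩⟩
              ⟨⟨N.mod.X, N.defAct, N.mod.coact, hobj N⟩⟩ f.hom),
          DoiHopf.deformationFunctor hobj hmap ⋙ DoiHopf.deformationFunctor hobj hmap =
            DoiHopf.deformationFunctor hobj hmap ∧
          ∀ (M : DoiHopf.StrongHopfModule b) (d : DoiHopf.CoinvTensor b M.X),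
            d.IsFor M.act M.coact →
            ∀ hT : DoiHopf.IsStrongHopfModule b d.actT d.coactT,
              (DoiHopf.deformationFunctor hobj hmap).obj ⟨⟨d.T, d.actT, d.coactT, hT⟩⟩ =
                ⟨⟨d.T, d.actT, d.coactT, hT⟩⟩) := by
  refine ⟨hh.nonempty_coinvImage, fun b hm hl =>
    ⟨fun M => M.isStrong.exists_coinvTensor hh hl, fun M d hd => ?_, fun 𝒟 => ?_⟩⟩
  · have hM := M.isStrong
    have hT := hd.isStrongHopfModule_tensor hh hm
    have hM' := hd.isStrongHopfModule_deformedAct hM hh hm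
    exact ⟨hT, hd.colinear hM hh, hM', hd.deformedAct_eq hM hh, hd.coinvEnd_deformedAct hM hh,
      hd.isFor_deformedAct hM hh, fun d' hd' => hd.deformedAct_deformedAct hM hh hM' hd',
      fun d' hd' => hd.deformedAct_tensor hh hl hT hd'⟩
  · have hobj : ∀ M : DoiHopf.SM 𝒟, DoiHopf.IsStrongHopfModule b M.defAct M.mod.coact :=
      fun M => (𝒟.isFor M.mod).isStrongHopfModule_deformedAct M.mod.isStrong hh hm
    -- The data chosen for the deformed module need not be those chosen for `M`; independence of the
    -- choice makes its deformed action equal to that of `M` anyway. Quasilinearity for the deformed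
    -- modules is thus the original condition.
    have hact : ∀ M : DoiHopf.SM 𝒟,
        DoiHopf.SM.defAct (𝒟 := 𝒟) ⟨⟨M.mod.X, M.defAct, M.mod.coact, hobj M⟩⟩ = M.defAct :=
      fun M => (𝒟.isFor M.mod).deformedAct_deformedAct M.mod.isStrong hh (hobj M)
        (𝒟.isFor ⟨M.mod.X, M.defAct, M.mod.coact, hobj M⟩)
    have hmap : ∀ (M N : DoiHopf.SM 𝒟) (f : M ⟶ N),
        DoiHopf.SM.IsMorphism (𝒟 := 𝒟) ⟨⟨M.mod.X, M.defAct, M.mod.coact, hobj M⟩⟩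
          ⟨⟨N.mod.X, N.defAct, N.mod.coact, hobj N⟩⟩ f.hom :=
      fun M N f => ⟨f.isMorphism.colinear, by
        rw [hact, hact]; exact f.isMorphism.quasilinear⟩
    have hDD : ∀ M : DoiHopf.SM 𝒟,
        (DoiHopf.deformationFunctor hobj hmap ⋙ DoiHopf.deformationFunctor hobj hmap).obj M =
          (DoiHopf.deformationFunctor hobj hmap).obj M := fun M => by
      simp only [DoiHopf.deformationFunctor, Functor.comp_obj, hact]
    refine ⟨hobj, hmap, CategoryTheory.Functor.hext hDD fun M N f =>
      DoiHopf.SM.hom_heq (hDD M) (hDD N) HEq.rfl, fun M d hd hT => ?_⟩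
    have h1 : DoiHopf.SM.defAct (𝒟 := 𝒟) ⟨⟨d.T, d.actT, d.coactT, hT⟩⟩ = d.actT :=
      hd.deformedAct_tensor hh hl hT (𝒟.isFor ⟨d.T, d.actT, d.coactT, hT⟩)
    simp only [DoiHopf.deformationFunctor, h1]
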